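/- **Setting.** Let $0<\Omega<1$, $\theta>0$, $\mu_0\in\mathbb R$, $M>1$, and $C=\frac{(1-\Omega)^2}{4\Omega}$. For $m\in\mathbb N^2$ let $\|m\|=m^1+m^2$. For $m,n,k,l\in\mathbb N^2$ and $i\ge 1$ let $$G^i_{m,n;k,l}=\frac{\theta}{8\Omega}\int_{M^{-i}}^{M^{-i+1}}\!d\alpha\,\frac{(1-\alpha)^{\mu_0^2\theta/(8\Omega)}}{(1+C\alpha)^2}\prod_{s=1}^{2}G^{(\alpha)}_{m^s,n^s;k^s,l^s},\qquad G_{m,n;k,l}=\frac{\theta}{8\Omega}\int_0^1 d\alpha\,(\text{same integrand}),$$ where $G^{(\alpha)}_{m,n;k,l}=0$ unless $m+k=n+l$, and otherwise $$G^{(\alpha)}_{m,n;k,l}=\Big(\tfrac{\sqrt{1-\alpha}}{1+C\alpha}\Big)^{m+k}\sum_{u=\max(0,m-n)}^{\min(m,l)}\sqrt{\tbinom{m}{m-u}\tbinom{n}{m-u}\tbinom{l}{l-u}\tbinom{k}{l-u}}\,\Big(\tfrac{C\alpha(1+\Omega)}{\sqrt{1-\alpha}(1-\Omega)}\Big)^{m+l-2u}.$$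 A $\phi^4$ ribbon graph $G$ is a finite connected orientable ribbon graph all of whose vertices have coordination $4$, with $V\ge1$ vertices, $I$ internal lines and $N\ge 1$ external legs. Its faces are the closed single lines obtained by connecting the two strands of each external leg with each other; they are the vertices of the dual graph, $V'=F$ is their number, and $B$ is the number of external faces (those carrying an external leg). The genus is $g=1-\frac12(V-I+F)$ and $\omega:=2(V'-B)-I$. A line is attached to a face if one of its strands belongs to that face. An index in $\mathbb N^2$ is attached to every corner of every vertex, so that a half-edge carries the two indices of its adjacent corners. The indices $(m_\epsilon,n_\epsilon)$, $\epsilon=1,\dots,N$, of the external legs are fixed. For a scale attribution $\mu=\{i_\delta\}$ (a positive integer for every internal line), $A_{G,\mu}$ is the sum, over all index assignments agreeing with the external indices, of $\prod_\delta G^{i_\delta}_{m_\delta,n_\delta;k_\delta,l_\delta}$, where $(m_\delta,n_\delta)$ and $(k_\delta,l_\delta)$ are the indices at the two ends of $\delta$. $A_G$ is the same sum with $G$ in place of $G^{i_\delta}$. Let $\delta_1\le\dots\le\delta_I$ be an enumeration of the lines with $i_{\delta_1}\le\dots\le i_{\delta_I}$ (ties broken arbitrarily). For $1\le\gamma\le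 I$ let $G_\gamma$ be the possibly disconnected subgraph made of the lines $\delta_{\gamma'}$, $\gamma'\ge\gamma$, and all vertices attached to them (all other half-edges at these vertices being external legs of $G_\gamma$), with numbers $V'_\gamma,B_\gamma,I_\gamma,N_\gamma,g_\gamma,\omega_\gamma$ defined as for $G$. For each internal (that is, not external) face $v$ let $\delta_v$ be the smallest line attached to $v$ in this order. For $K,c>0$ put $$\mathcal B_\mu=\frac{K^I}{c^{2(V'-B)}}\,M^{-\sum_\delta i_\delta}\,M^{2\sum_v i_{\delta_v}}\prod_{\epsilon=1}^N e^{-cM^{-i(m_\epsilon)}\|m_\epsilon\|}\prod_{\epsilon=1}^N e^{-cM^{-i(n_\epsilon)}\|n_\epsilon\|},$$ where $v$ runs over the internal faces, $i(m_\epsilon)$ (resp. $i(n_\epsilon)$) is the scale of the internal line whose half-edge is adjacent to leg $\epsilon$ at the corner carrying $m_\epsilon$ (resp. $n_\epsilon$), and the factor is replaced by $1$ if the half-edge adjacent there is an external leg. **Theorem.** There are constants $K,c>0$, depending only on $\Omega,\theta,\mu_0,M$, such that for every $\phi^4$ ribbon graph $G$ as above and all external indices: 1. For every scale attribution $\mu$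 and every compatible order of the lines, the sum defining $A_{G,\mu}$ converges and $A_{G,\mu}\le\mathcal B_\mu$. 2. For every fixed order of the lines, if $\omega_\gamma<0$ for all subgraphs $G_\gamma$ of this order, then the sum of $\mathcal B_\mu$ over all scale attributions $\mu$ compatible with this order converges. 3. Choose for each $\mu$ a compatible order. If $\omega_\gamma<0$ for all the subgraphs $G_\gamma$ of all $\mu$, then $\sum_\mu\mathcal B_\mu$ converges; moreover the sum defining $A_G$ converges, $A_G=\sum_\mu A_{G,\mu}$, and $A_G\le\sum_\mu\mathcal B_\mu$. 4. For all these subgraphs $\omega_\gamma=2(V'_\gamma-B_\gamma)-I_\gamma=(2-\frac{N_\gamma}2)-2(2g_\gamma+B_\gamma-1)$. For the whole graph $\gamma=1$ one has $\omega_1=\omega$, and $\omega=(2-\frac N2)-2(2g+B-1)$. -/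

import Mathlib

open scoped BigOperators

noncomputable section

namespace RibbonPhi4

/-! ### The propagator in the matrix base of the four-dimensional Moyal plane -/

/-- A matrix index in `ℕ²`, one component for each symplectic pair of `ℝ⁴`. -/
abbrev Index := Fin 2 → ℕ

/-- The norm `‖m‖ = m¹ + m²` of a matrix index. -/
def Index.size (m : Index) : ℝ := ∑ s, (m s : ℝ)

/-- `C(Ω) = (1 - Ω)² / (4 Ω)`. -/
def constC (Ω : ℝ) : ℝ := (1 - Ω) ^ 2 / (4 * Ω)

/-- The one-component kernel `G^{(α)}_{m,n;k,l}`. It vanishes unless `m + k = n + l`; writing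
`n = m + h` and `k = l + h`, the summation index `u` runs from `max 0 (-h) = m - n` (truncated
subtraction) to `min m l`, and `m + l + h = m + k`. -/
def kernel (Ω α : ℝ) (m n k l : ℕ) : ℝ :=
  if m + k = n + l then
    (Real.sqrt (1 - α) / (1 + constC Ω * α)) ^ (m + k) *
      ∑ u ∈ Finset.Icc (m - n) (min m l),
        Real.sqrt ((m.choose (m - u) : ℝ) * (n.choose (m - u) : ℝ) *
            (l.choose (l - u) : ℝ) * (k.choose (l - u) : ℝ)) *
          (constC Ω * α * (1 + Ω) / (Real.sqrt (1 - α) * (1 - Ω))) ^ ((m - u) + (l - u))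
  else 0

/-- The integrand of the `α`-representation of the propagator in dimension `D = 4`
(so that `D / 4 - 1 = 0` and `D / 2 = 2`). -/
def integrand (Ω θ μ₀ : ℝ) (m n k l : Index) (α : ℝ) : ℝ :=
  (1 - α) ^ (μ₀ ^ 2 * θ / (8 * Ω)) / (1 + constC Ω * α) ^ 2 *
    ∏ s, kernel Ω α (m s) (n s) (k s) (l s)

/-- The propagator `G_{m,n;k,l}`. -/
def propagator (Ω θ μ₀ : ℝ) (m n k l : Index) : ℝ :=
  θ / (8 * Ω) * ∫ α in (0 : ℝ)..1, integrand Ω θ μ₀ m n k l α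

/-- The propagator `G^i_{m,n;k,l}` of the `i`-th slice `M^{-i} ≤ α ≤ M^{-i+1}`. -/
def slicePropagator (Ω θ μ₀ M : ℝ) (i : ℕ+) (m n k l : Index) : ℝ :=
  θ / (8 * Ω) *
    ∫ α in (M ^ (-((i : ℕ) : ℤ)))..(M ^ (-((i : ℕ) : ℤ) + 1)), integrand Ω θ μ₀ m n k l α

/-! ### Ribbon graphs -/

/-- The half-edges of a graph with set of internal lines `L` and set of external legs `E`:
each line has two ends, each external leg is one half-edge. -/
abbrev HalfEdge (L E : Type*) := (L × Bool) ⊕ E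

/-- The involution that exchanges the two ends of every line and fixes the external legs. -/
def glue (L E : Type*) : Equiv.Perm (HalfEdge L E) :=
  Equiv.sumCongr (Equiv.prodCongr (Equiv.refl L) Equiv.boolNot) (Equiv.refl E)

/-- An (orientable) ribbon graph with lines `L` and external legs `E`: the permutation `rot` sends
a half-edge to the next one in the cyclic order around its vertex, so vertices are the cycles of
`rot`. The corner between `rot⁻¹ h` and `h` is labelled by `h`. The half-edge `h` thus has the corner
`h` on its one side and the corner `rot h` on its other side. -/
structure RibbonGraph (L E : Type*) where
  rot : Equiv.Perm (HalfEdge L E)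

namespace RibbonGraph

variable {L E : Type*} (G : RibbonGraph L E)

/-- Every vertex has coordination exactly four. -/
def IsPhi4 : Prop := ∀ h, (G.rot ^ 4) h = h ∧ (G.rot ^ 2) h ≠ h

/-- The graph is non-empty and connected. -/
def IsConnected : Prop :=
  Nonempty (HalfEdge L E) ∧
    ∀ x y, Relation.ReflTransGen (fun a b => b = G.rot a ∨ b = glue L E a) x y

/-- Following a single line of the ribbon graph from corner to corner. The strand that starts at the
corner of one end of a line arrives at the far corner of the other end; at an external leg, the two
strands of the leg are connected with each other. -/
def facePerm : Equiv.Perm (HalfEdge L E) := G.rot * glue L E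

/-- The vertices of the graph. -/
def Vertex : Type _ := Quotient (Equiv.Perm.SameCycle.setoid G.rot)

/-- The faces of the graph (external legs being closed), that is, the vertices of the dual graph. -/
def Face : Type _ := Quotient (Equiv.Perm.SameCycle.setoid G.facePerm)

/-- The face through a given corner. -/
def faceOf (h : HalfEdge L E) : G.Face := Quotient.mk _ h

/-- A face is external if it carries an external leg. -/
def IsExternal (f : G.Face) : Prop := ∃ j : E, G.faceOf (Sum.inr j) = f

/-- A line is attached to a face (a vertex of the dual graph) if one of its two strands belongs to
that face. -/
def Attached (f : G.Face) (δ : L) : Prop := ∃ b : Bool, G.faceOf (Sum.inl (δ, b)) = f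

/-- The number `V` of vertices. -/
def numVertices : ℕ := Nat.card G.Vertex

/-- The number `I` of (internal) lines. -/
def numLines (_G : RibbonGraph L E) : ℕ := Nat.card L

/-- The number `N` of external legs. -/
def numLegs (_G : RibbonGraph L E) : ℕ := Nat.card E

/-- The number `F = V'` of faces, that is, of vertices of the dual graph. -/
def numFaces : ℕ := Nat.card G.Face

/-- The number `B` of external faces. -/
def numExternalFaces : ℕ := Nat.card {f : G.Face // G.IsExternal f}

/-- The genus `g = 1 - (V - I + F) / 2`. -/
def genus : ℚ := 1 - ((G.numVertices : ℚ) - G.numLines + G.numFaces) / 2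

/-- The power-counting degree `ω = 2 (V' - B) - I`. -/
def omega : ℤ := 2 * ((G.numFaces : ℤ) - G.numExternalFaces) - G.numLines

/-! ### Subgraphs -/

/-- The half-edge `h` sits at a vertex to which some line of `S` is attached. -/
def InSub (S : Finset L) (h : HalfEdge L E) : Prop :=
  ∃ δ ∈ S, ∃ b : Bool, G.rot.SameCycle (Sum.inl (δ, b)) h

/-- The external legs of the subgraph with set of lines `S`: all half-edges at the vertices attached
to `S` that are not ends of lines of `S`. -/
abbrev SubLeg (S : Finset L) : Type _ :=
  {h : HalfEdge L E // G.InSub S h ∧ ∀ δ ∈ S, ∀ b : Bool, h ≠ Sum.inl (δ, b)}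

/-- The inclusion of the half-edges of the subgraph. -/
def subIncl (S : Finset L) : HalfEdge {δ // δ ∈ S} (G.SubLeg S) → {h // G.InSub S h}
  | Sum.inl (δ, b) => ⟨Sum.inl (δ.1, b), δ.1, δ.2, b, Equiv.Perm.SameCycle.refl _ _⟩
  | Sum.inr x => ⟨x.1, x.2.1⟩

theorem subIncl_bijective (S : Finset L) : Function.Bijective (G.subIncl S) := by
  constructor
  · rintro (⟨⟨δ, hδ⟩, b⟩ | ⟨x, hx, hx'⟩) (⟨⟨δ', hδ'⟩, b'⟩ | ⟨y, hy, hy'⟩) h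
    · cases h
      rfl
    · exact absurd (congrArg Subtype.val h).symm (hy' δ hδ b)
    · exact absurd (congrArg Subtype.val h) (hx' δ' hδ' b')
    · have : x = y := congrArg Subtype.val h
      subst this
      rfl
  · rintro ⟨h, hh⟩
    by_cases hx : ∀ δ ∈ S, ∀ b : Bool, h ≠ Sum.inl (δ, b)
    · exact ⟨Sum.inr ⟨h, hh, hx⟩, rfl⟩
    · push Not at hx
      obtain ⟨δ, hδ, b, rfl⟩ := hx
      exact ⟨Sum.inl (⟨δ, hδ⟩, b), rfl⟩

theorem inSub_rot (S : Finset L) (h : HalfEdge L E) : G.InSub S (G.rot h) ↔ G.InSub S h := by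
  simp only [InSub, Equiv.Perm.sameCycle_apply_right]

/-- The subgraph with set of lines `S`, together with all vertices attached to them. -/
def sub (S : Finset L) : RibbonGraph {δ // δ ∈ S} (G.SubLeg S) where
  rot := (Equiv.ofBijective _ (G.subIncl_bijective S)).symm.permCongr
    (G.rot.subtypePerm (fun h => G.inSub_rot S h))

/-! ### Amplitudes -/

/-- Assignments of an index to every corner that agree with the given external indices: the leg `j`
has the two indices `m j` and `n j`. -/
def Assignment (m n : E → Index) : Type _ :=
  {a : HalfEdge L E → Index //
    ∀ j : E, a (Sum.inr j) = m j ∧ a (G.rot (Sum.inr j)) = n j}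

variable [Fintype L]

/-- The contribution of one index assignment when the line `δ` has the propagator `P δ`. The end
`(δ, true)` carries the indices `(m, n)` and the end `(δ, false)` carries the indices `(k, l)` of
`P_{m,n;k,l}`. -/
def weight (P : L → Index → Index → Index → Index → ℝ) (a : HalfEdge L E → Index) : ℝ :=
  ∏ δ, P δ (a (Sum.inl (δ, true))) (a (G.rot (Sum.inl (δ, true))))
    (a (Sum.inl (δ, false))) (a (G.rot (Sum.inl (δ, false))))

/-- The terms of the amplitude `A_G` with external indices `m, n`. -/
def term (Ω θ μ₀ : ℝ) (m n : E → Index) (a : G.Assignment m n) : ℝ :=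
  G.weight (fun _ => propagator Ω θ μ₀) a.1

/-- The terms of the amplitude `A_{G,μ}` with scale attribution `μ` and external indices `m, n`. -/
def sliceTerm (Ω θ μ₀ M : ℝ) (μ : L → ℕ+) (m n : E → Index) (a : G.Assignment m n) : ℝ :=
  G.weight (fun δ => slicePropagator Ω θ μ₀ M (μ δ)) a.1

/-- The amplitude `A_G`. -/
def amplitude (Ω θ μ₀ : ℝ) (m n : E → Index) : ℝ := ∑' a, G.term Ω θ μ₀ m n a

/-- The amplitude `A_{G,μ}`. -/
def sliceAmplitude (Ω θ μ₀ M : ℝ) (μ : L → ℕ+) (m n : E → Index) : ℝ :=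
  ∑' a, G.sliceTerm Ω θ μ₀ M μ m n a

/-! ### The scale order, the high-scale subgraphs and the amplitude bound -/

/-- The enumeration `o` of the lines is ordered by the scale attribution `μ`:
`i_{δ_1} ≤ i_{δ_2} ≤ … ≤ i_{δ_I}`. -/
def IsScaleOrder (μ : L → ℕ+) (o : Fin (Fintype.card L) ≃ L) : Prop := Monotone (μ ∘ o)

/-- The subgraph `G_γ` made of all lines `δ_{γ'}` with `γ' ≥ γ` and the vertices attached
to them. -/
def highSub (o : Fin (Fintype.card L) ≃ L) (γ : Fin (Fintype.card L)) :=
  G.sub ((Finset.univ.filter fun γ' => γ ≤ γ').map o.toEmbedding)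

/-- `δ` is the smallest line attached to the face (dual vertex) `f`. -/
def IsSmallestAt (o : Fin (Fintype.card L) ≃ L) (f : G.Face) (δ : L) : Prop :=
  G.Attached f δ ∧ ∀ δ', G.Attached f δ' → o.symm δ ≤ o.symm δ'

/-- The multiplicity of the line `δ` in the family of lines that carry a main reference index: the
number of internal faces `f` whose smallest line is `δ`. -/
def mainMult (o : Fin (Fintype.card L) ≃ L) (δ : L) : ℕ :=
  Nat.card {f : G.Face // ¬ G.IsExternal f ∧ G.IsSmallestAt o f δ}

/-- The decay of an external index `x` at a corner whose other side is the half-edge `h`: a factor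
`exp (-c M^{-i} ‖x‖)` if `h` is an end of an internal line of scale `i`, and `1` otherwise. -/
def legDecay (M c : ℝ) (μ : L → ℕ+) (x : Index) : HalfEdge L E → ℝ
  | Sum.inl (δ, _) => Real.exp (-c * M ^ (-((μ δ : ℕ) : ℤ)) * x.size)
  | Sum.inr _ => 1

/-- The term of scale attribution `μ` in the amplitude bound:
`K^I / c^{2(V'-B)} * M^{-∑ i_δ} * M^{2 ∑ i_{δ'}} * ∏ (decay of m_ε) * ∏ (decay of n_ε)`,
where `δ` runs over all lines and `δ'` over the lines that carry a main reference index. -/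
def scaleBound [Fintype E] (M K c : ℝ) (o : Fin (Fintype.card L) ≃ L) (μ : L → ℕ+)
    (m n : E → Index) : ℝ :=
  K ^ G.numLines / c ^ (2 * (G.numFaces - G.numExternalFaces)) *
    M ^ (-∑ δ, ((μ δ : ℕ) : ℤ)) *
    M ^ (2 * ∑ δ, (G.mainMult o δ : ℤ) * ((μ δ : ℕ) : ℤ)) *
    (∏ j, legDecay M c μ (m j) (G.rot.symm (Sum.inr j))) *
    ∏ j, legDecay M c μ (n j) (G.rot (Sum.inr j))

end RibbonGraph

end RibbonPhi4

end

noncomputable section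

namespace RibbonPhi4

open scoped ENNReal

/-! The argument joins an estimate on a single line to a summation over the graph that pays for each
line only once.

One line. After absorbing a factor `exp (ε * α)` into each of `stayFactor` (x) and `hopFactor` (y),
the kernel becomes an exponential decay in its indices times a sum of products of four square roots
of binomial weights (`kernel_eq`). Since x + e^ε y ≤ 1 on [0, 1] (`exists_rate`), every such weight
is at most 1. Dropping two of the four leaves a majorant that sees the two indices of one strand
only and is summable over the far index uniformly in the near one (`tsum_hopWeight_le`). On slice i
a line therefore gives decay at rate M^{-i} in its four indices, and a strand sum of order M^{-i},
the length of the slice (`ofReal_slicePropagator_le`, `tsum_sliceMajorant_le`).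

The graph. Indices are determined corner by corner along the faces, starting from the leg corners on
external faces and from a reference corner on internal ones. Crossing a strand costs a sum over its
far index. A line has two strands, but once one is known, index conservation fixes the last index of
the other, so each line costs M^{-i} once (`tsum_lineBound_le`, `tsum_corners_le`). Each reference
index is summed with the decay of its line and costs a multiple of M^{2i}, which is why it is placed
on the smallest line of its face. `tsum_sliceTerm_le` collects these factors.

Power counting. An internal face of the graph is an internal face of G_γ exactly when its smallest
line belongs to G_γ, so ω_γ is the sum over k ≥ γ of twice the number of faces led by δ_k, minus 1
(`omega_highSub`). Summation by layers turns ω_γ ≤ -1 into a total exponent of at most minus the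
largest scale (`sum_mul_le_neg_of_tail`), hence geometric decay in every scale. All terms are
nonnegative, so the sums over scales and over indices may be exchanged (`hasSum_sliceAmplitude`).
The degree formula is the count 4V = 2I + N of half-edges. -/

/-- In `ℝ≥0∞`, a finite product of sums is the sum over all choices of the products. -/
theorem ennreal_prod_tsum {ι X : Type*} [Fintype ι] (f : ι → X → ℝ≥0∞) :
    ∏ i, ∑' x, f i x = ∑' a : ι → X, ∏ i, f i (a i) := by
  revert f
  refine Fintype.induction_empty_option (P := fun ι _ => ∀ f : ι → X → ℝ≥0∞,
    ∏ i, ∑' x, f i x = ∑' a : ι → X, ∏ i, f i (a i)) ?_ ?_ ?_ ι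
  · intro α β _ e ih f
    let _ := Fintype.ofEquiv β e.symm
    have ih' := ih (fun i => f (e i))
    rw [← Equiv.prod_comp e, ← Equiv.tsum_eq (Equiv.arrowCongr e (Equiv.refl X))]
    convert ih' using 3 with a
    rw [← Equiv.prod_comp e]
    simp [Equiv.arrowCongr]
  · intro f
    simp [tsum_fintype]
  · intro α _ ih f
    rw [Fintype.prod_option, ih (fun i => f (some i)),
      ← Equiv.tsum_eq (Equiv.piOptionEquivProd (β := fun _ => X)).symm, ENNReal.tsum_prod',
      ← ENNReal.tsum_mul_right]
    refine tsum_congr fun x => ?_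
    rw [← ENNReal.tsum_mul_left]
    refine tsum_congr fun a => ?_
    rw [Fintype.prod_option]
    simp [Equiv.piOptionEquivProd]

/-! ### Summation over corner indices along the faces. -/

namespace RibbonGraph

variable {L E : Type*} (G : RibbonGraph L E)

theorem facePerm_inl (δ : L) (b : Bool) :
    G.facePerm (Sum.inl (δ, b)) = G.rot (Sum.inl (δ, !b)) := rfl

/-- Both corners of the strand starting at `(δ, b)` lie outside `U`. -/
def StrandKnown (U : Finset (HalfEdge L E)) (δ : L) (b : Bool) : Prop :=
  (Sum.inl (δ, b) : HalfEdge L E) ∉ U ∧ G.facePerm (Sum.inl (δ, b)) ∉ U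

/-- Conservation of the index along the line `δ`. -/
def Conserved (a : HalfEdge L E → Index) (δ : L) : Prop :=
  a (Sum.inl (δ, true)) + a (Sum.inl (δ, false)) =
    a (G.facePerm (Sum.inl (δ, false))) + a (G.facePerm (Sum.inl (δ, true)))

open Classical in
/-- The bound for the weight of the line `δ` after summation over the indices of the corners
in `U`. -/
def lineBound (J : L → Index → Index → ℝ≥0∞) (κ : L → ℝ≥0∞) (U : Finset (HalfEdge L E))
    (a : HalfEdge L E → Index) (δ : L) : ℝ≥0∞ :=
  κ δ ⊓ (⨅ b : Bool, if G.StrandKnown U δ b then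
      J δ (a (Sum.inl (δ, b))) (a (G.facePerm (Sum.inl (δ, b)))) else ⊤) ⊓
    (if (∀ b, G.StrandKnown U δ b) ∧ ¬ G.Conserved a δ then 0 else ⊤)

variable {G}

theorem StrandKnown.erase [DecidableEq (HalfEdge L E)] {U : Finset (HalfEdge L E)} {δ : L}
    {b : Bool} (h : G.StrandKnown U δ b) (y : HalfEdge L E) : G.StrandKnown (U.erase y) δ b :=
  ⟨fun h' => h.1 (Finset.mem_of_mem_erase h'), fun h' => h.2 (Finset.mem_of_mem_erase h')⟩

theorem StrandKnown.update_eq [DecidableEq (HalfEdge L E)] {U : Finset (HalfEdge L E)} {δ : L}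
    {b : Bool} (h : G.StrandKnown U δ b) {y : HalfEdge L E} (hy : y ∈ U)
    (a : HalfEdge L E → Index) (z : Index) :
    Function.update a y z (Sum.inl (δ, b)) = a (Sum.inl (δ, b)) ∧
      Function.update a y z (G.facePerm (Sum.inl (δ, b))) = a (G.facePerm (Sum.inl (δ, b))) :=
  ⟨Function.update_of_ne (by rintro rfl; exact h.1 hy) _ _,
    Function.update_of_ne (by rintro rfl; exact h.2 hy) _ _⟩

theorem lineBound_le_const (J : L → Index → Index → ℝ≥0∞) (κ : L → ℝ≥0∞)
    (U : Finset (HalfEdge L E)) (a : HalfEdge L E → Index) (δ : L) :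
    G.lineBound J κ U a δ ≤ κ δ := inf_le_left.trans inf_le_left

theorem lineBound_le_strand {J : L → Index → Index → ℝ≥0∞} {κ : L → ℝ≥0∞}
    {U : Finset (HalfEdge L E)} {a : HalfEdge L E → Index} {δ : L} {b : Bool}
    (h : G.StrandKnown U δ b) :
    G.lineBound J κ U a δ ≤ J δ (a (Sum.inl (δ, b))) (a (G.facePerm (Sum.inl (δ, b)))) :=
  (inf_le_left.trans inf_le_right).trans ((iInf_le _ b).trans (by rw [if_pos h]))

theorem lineBound_eq_zero {J : L → Index → Index → ℝ≥0∞} {κ : L → ℝ≥0∞}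
    {U : Finset (HalfEdge L E)} {a : HalfEdge L E → Index} {δ : L}
    (h : ∀ b, G.StrandKnown U δ b) (h' : ¬ G.Conserved a δ) :
    G.lineBound J κ U a δ = 0 :=
  le_antisymm (inf_le_right.trans (by rw [if_pos ⟨h, h'⟩])) zero_le

/-- Fixing one more corner only adds constraints: a strand already known avoids the corner being
fixed, so its indices do not move. -/
theorem lineBound_erase_le [DecidableEq (HalfEdge L E)] (J : L → Index → Index → ℝ≥0∞)
    (κ : L → ℝ≥0∞) {U : Finset (HalfEdge L E)} {y : HalfEdge L E} (hy : y ∈ U)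
    (a : HalfEdge L E → Index) (z : Index) (δ : L) :
    G.lineBound J κ (U.erase y) (Function.update a y z) δ ≤ G.lineBound J κ U a δ := by
  refine le_inf (le_inf (lineBound_le_const ..) (le_iInf fun b => ?_)) ?_
  · split_ifs with h
    · refine (lineBound_le_strand (h.erase y)).trans ?_
      rw [(h.update_eq hy a z).1, (h.update_eq hy a z).2]
    · exact le_top
  · split_ifs with h
    · rw [lineBound_eq_zero (fun b => (h.1 b).erase y)]
      intro hc
      apply h.2
      simpa only [Conserved, ((h.1 _).update_eq hy a z).1, ((h.1 _).update_eq hy a z).2] using hc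
    · exact le_top

/-- Summing over the far corner of a strand whose near corner is known. -/
theorem tsum_lineBound_le [DecidableEq (HalfEdge L E)] {J : L → Index → Index → ℝ≥0∞}
    {κ : L → ℝ≥0∞} (hκ : ∀ δ m, ∑' l, J δ m l ≤ κ δ) {U : Finset (HalfEdge L E)} {δ : L}
    {b : Bool} (hx : (Sum.inl (δ, b) : HalfEdge L E) ∉ U)
    (hy : G.facePerm (Sum.inl (δ, b)) ∈ U) (a : HalfEdge L E → Index) :
    ∑' z, G.lineBound J κ (U.erase (G.facePerm (Sum.inl (δ, b))))
      (Function.update a (G.facePerm (Sum.inl (δ, b))) z) δ ≤ G.lineBound J κ U a δ := by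
  set y := G.facePerm (Sum.inl (δ, b)) with hydef
  have hxy : (Sum.inl (δ, b) : HalfEdge L E) ≠ y := fun h => hx (h ▸ hy)
  have hself : G.StrandKnown (U.erase y) δ b :=
    ⟨fun h => hx (Finset.mem_of_mem_erase h), by rw [← hydef]; simp⟩
  -- If the other strand is already known, conservation allows at most one value of the new index
  -- and no sum is paid. Otherwise the old bound is the constant `κ δ`, and the strand sum of `J` is
  -- paid out of it.
  by_cases ht : G.StrandKnown U δ (!b)
  · have hall : ∀ c, G.StrandKnown (U.erase y) δ c := by
      intro c
      rcases Bool.eq_or_eq_not c b with rfl | rfl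
      · exact hself
      · exact ht.erase y
    have hzero : ∀ z z', G.Conserved (Function.update a y z) δ →
        G.Conserved (Function.update a y z') δ → z = z' := by
      intro z z' h h'
      have e1 := (ht.update_eq hy a z)
      have e2 := (ht.update_eq hy a z')
      have e3 : ∀ z, Function.update a y z (Sum.inl (δ, b)) = a (Sum.inl (δ, b)) :=
        fun z => Function.update_of_ne hxy _ _
      have e4 : ∀ z, Function.update a y z (G.facePerm (Sum.inl (δ, b))) = z :=
        fun z => Function.update_self _ _ _
      unfold Conserved at h h'
      cases b
      · rw [Bool.not_false] at e1 e2
        rw [e3, e4, e1.1, e1.2] at h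
        rw [e3, e4, e2.1, e2.2, h] at h'
        exact add_right_cancel h'
      · rw [Bool.not_true] at e1 e2
        rw [e3, e4, e1.1, e1.2] at h
        rw [e3, e4, e2.1, e2.2, h] at h'
        exact add_left_cancel h'
    by_cases hex : ∃ z, G.Conserved (Function.update a y z) δ
    · obtain ⟨z, hz⟩ := hex
      rw [tsum_eq_single z]
      · exact lineBound_erase_le J κ hy a z δ
      · intro z' hz'
        exact lineBound_eq_zero hall fun h => hz' (hzero _ _ h hz)
    · push Not at hex
      simp [lineBound_eq_zero hall (hex _)]
  · have hnk : ∀ c, ¬ G.StrandKnown U δ c := by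
      intro c hc
      rcases Bool.eq_or_eq_not c b with rfl | rfl
      · exact hc.2 hy
      · exact ht hc
    have : G.lineBound J κ U a δ = κ δ := by
      simp [lineBound, hnk]
    rw [this]
    refine le_trans (ENNReal.tsum_le_tsum fun z => lineBound_le_strand hself) ?_
    have e3 : ∀ z, Function.update a y z (Sum.inl (δ, b)) = a (Sum.inl (δ, b)) :=
      fun z => Function.update_of_ne hxy _ _
    have e4 : ∀ z, Function.update a y z (G.facePerm (Sum.inl (δ, b))) = z :=
      fun z => Function.update_self _ _ _
    simp only [e3, e4]
    exact hκ _ _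

/-- Splitting off the value at `y` embeds the assignments into a disjoint union; for nonnegative
terms an injection is enough for the inequality. -/
theorem tsum_agree_le [DecidableEq (HalfEdge L E)] (U : Finset (HalfEdge L E))
    (y : HalfEdge L E) (a₀ : HalfEdge L E → Index) (W : (HalfEdge L E → Index) → ℝ≥0∞) :
    ∑' a : {a : HalfEdge L E → Index // ∀ h, h ∉ U → a h = a₀ h}, W a.1 ≤
      ∑' z, ∑' a : {a : HalfEdge L E → Index //
        ∀ h, h ∉ U.erase y → a h = Function.update a₀ y z h}, W a.1 := by
  rw [← ENNReal.tsum_sigma' (f := fun p : Σ z, {a : HalfEdge L E → Index //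
        ∀ h, h ∉ U.erase y → a h = Function.update a₀ y z h} => W p.2.1)]
  let φ : {a : HalfEdge L E → Index // ∀ h, h ∉ U → a h = a₀ h} →
      Σ z, {a : HalfEdge L E → Index // ∀ h, h ∉ U.erase y → a h = Function.update a₀ y z h} :=
    fun a => ⟨a.1 y, a.1, fun h hh => by
      by_cases e : h = y
      · subst e; simp
      · rw [Function.update_of_ne e]
        exact a.2 h fun h' => hh (Finset.mem_erase.2 ⟨e, h'⟩)⟩
  have hφ : Function.Injective φ := by
    intro a a' h
    have : (φ a).2.1 = (φ a').2.1 := by rw [h]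
    exact Subtype.ext this
  exact ENNReal.tsum_comp_le_tsum_of_injective hφ (fun p => W p.2.1)

variable [Fintype L]

open Classical in
/-- Summation over the unknown corners, following the faces: each line contributes at most one
sum over a difference of indices, and each reference corner in `R` one sum over its index. -/
theorem tsum_corners_le {J : L → Index → Index → ℝ≥0∞} {κ : L → ℝ≥0∞}
    (hκ : ∀ δ m, ∑' l, J δ m l ≤ κ δ)
    {w : L → Index → Index → Index → Index → ℝ≥0∞}
    (hw₁ : ∀ δ m n k l, w δ m n k l ≤ J δ m l) (hw₂ : ∀ δ m n k l, w δ m n k l ≤ J δ k n)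
    (hw₀ : ∀ δ m n k l, m + k ≠ n + l → w δ m n k l = 0)
    (R : Finset (HalfEdge L E)) {e : HalfEdge L E → Index → ℝ≥0∞} {S : HalfEdge L E → ℝ≥0∞}
    (hS : ∀ h ∈ R, ∑' z, e h z ≤ S h) :
    ∀ (U : Finset (HalfEdge L E)), (∀ j, G.facePerm (Sum.inr j) ∉ U) →
      (∀ h, ∃ k, (k ∉ U ∨ k ∈ R) ∧ ∃ n : ℕ, (G.facePerm ^ n) k = h) →
      ∀ a₀ : HalfEdge L E → Index,
        ∑' a : {a : HalfEdge L E → Index // ∀ h, h ∉ U → a h = a₀ h},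
          (∏ h ∈ R, e h (a.1 h)) * ∏ δ, w δ (a.1 (Sum.inl (δ, true)))
            (a.1 (G.rot (Sum.inl (δ, true)))) (a.1 (Sum.inl (δ, false)))
            (a.1 (G.rot (Sum.inl (δ, false)))) ≤
        (∏ h ∈ R, if h ∈ U then S h else e h (a₀ h)) * ∏ δ, G.lineBound J κ U a₀ δ := by
  intro U
  induction hn : U.card generalizing U with
  | zero =>
    intro _ _ a₀
    obtain rfl := Finset.card_eq_zero.1 hn
    let _ : Unique {a : HalfEdge L E → Index // ∀ h, h ∉ (∅ : Finset (HalfEdge L E)) →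
        a h = a₀ h} :=
      { default := ⟨a₀, fun _ _ => rfl⟩
        uniq := fun a => Subtype.ext (funext fun h => a.2 h (Finset.notMem_empty h)) }
    have hd : (default : {a : HalfEdge L E → Index //
        ∀ h, h ∉ (∅ : Finset (HalfEdge L E)) → a h = a₀ h}).1 = a₀ := rfl
    rw [tsum_fintype, Fintype.sum_unique, hd]
    simp only [Finset.notMem_empty, if_false]
    gcongr with δ
    -- With every corner known, the weight itself must lie below each of the three bounds; a single
    -- value of `J` is below its strand sum.
    refine le_inf (le_inf ?_ (le_iInf fun b => ?_)) ?_
    · exact (hw₁ ..).trans ((ENNReal.le_tsum _).trans (hκ δ _))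
    · refine le_trans ?_ (le_of_eq (if_pos ⟨by simp, by simp⟩).symm)
      cases b
      · exact hw₂ ..
      · exact hw₁ ..
    · split_ifs with h
      · exact (hw₀ _ _ _ _ _ h.2).le
      · exact le_top
  | succ n ih =>
    intro hleg hcov a₀
    have key : ∀ y ∈ U, (∑' z, (∏ h ∈ R, if h ∈ U.erase y then S h else
        e h (Function.update a₀ y z h)) *
          ∏ δ, G.lineBound J κ (U.erase y) (Function.update a₀ y z) δ ≤
        (∏ h ∈ R, if h ∈ U then S h else e h (a₀ h)) * ∏ δ, G.lineBound J κ U a₀ δ) →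
        ∑' a : {a : HalfEdge L E → Index // ∀ h, h ∉ U → a h = a₀ h},
          (∏ h ∈ R, e h (a.1 h)) * ∏ δ, w δ (a.1 (Sum.inl (δ, true)))
            (a.1 (G.rot (Sum.inl (δ, true)))) (a.1 (Sum.inl (δ, false)))
            (a.1 (G.rot (Sum.inl (δ, false)))) ≤
        (∏ h ∈ R, if h ∈ U then S h else e h (a₀ h)) * ∏ δ, G.lineBound J κ U a₀ δ := by
      intro y hy hle
      refine (tsum_agree_le U y a₀ (fun a => (∏ h ∈ R, e h (a h)) *
        ∏ δ, w δ (a (Sum.inl (δ, true))) (a (G.rot (Sum.inl (δ, true))))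
          (a (Sum.inl (δ, false))) (a (G.rot (Sum.inl (δ, false)))))).trans
        (le_trans (ENNReal.tsum_le_tsum fun z => ?_) hle)
      refine ih (U.erase y) (by rw [Finset.card_erase_of_mem hy, hn]; rfl)
        (fun j h => hleg j (Finset.mem_of_mem_erase h)) (fun h => ?_) _
      obtain ⟨k, hk, hk'⟩ := hcov h
      exact ⟨k, hk.imp_left fun h h' => h (Finset.mem_of_mem_erase h'), hk'⟩
    -- Reference corners are summed first, each against its own decay factor. Only afterwards do
    -- indices spread along the faces.
    by_cases hR : ∃ y ∈ R, y ∈ U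
    · obtain ⟨y, hyR, hyU⟩ := hR
      refine key y hyU ?_
      have h1 : ∀ z, (∏ h ∈ R, if h ∈ U.erase y then S h else e h (Function.update a₀ y z h)) *
          ∏ δ, G.lineBound J κ (U.erase y) (Function.update a₀ y z) δ ≤
          e y z * ((∏ h ∈ R.erase y, if h ∈ U then S h else e h (a₀ h)) *
            ∏ δ, G.lineBound J κ U a₀ δ) := by
        intro z
        rw [← Finset.mul_prod_erase R _ hyR, mul_assoc]
        simp only [Finset.mem_erase, ne_eq, not_true_eq_false, false_and, if_false,
          Function.update_self]
        gcongr with h hh δ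
        · refine le_of_eq ?_
          have hne : h ≠ y := (Finset.mem_erase.1 hh).1
          simp [hne]
        · exact lineBound_erase_le J κ hyU a₀ z δ
      refine (ENNReal.tsum_le_tsum h1).trans ?_
      rw [ENNReal.tsum_mul_right, ← Finset.mul_prod_erase R _ hyR, if_pos hyU, mul_assoc]
      gcongr
      exact hS y hyR
    · push Not at hR
      obtain ⟨y₀, hy₀⟩ : U.Nonempty := Finset.card_pos.1 (by omega)
      -- Every face orbit now contains a known corner, so walking from it to an unknown one crosses
      -- the boundary of `U` at some strand.
      obtain ⟨x, hxU, hyU⟩ : ∃ x, x ∉ U ∧ G.facePerm x ∈ U := by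
        obtain ⟨k, hk, N, hN⟩ := hcov y₀
        have hkU : k ∉ U := hk.elim id (hR k)
        by_contra! hcon
        have : ∀ N : ℕ, (G.facePerm ^ N) k ∉ U := by
          intro N
          induction N with
          | zero => simpa using hkU
          | succ N ihN => rw [pow_succ']; exact hcon _ ihN
        exact this N (hN ▸ hy₀)
      obtain ⟨δ₀, b⟩ | j := x
      swap
      · exact absurd hyU (hleg j)
      refine key _ hyU ?_
      have hRU : ∀ h ∈ R, h ≠ G.facePerm (Sum.inl (δ₀, b)) := fun h hh e => hR h hh (e ▸ hyU)
      have h1 : ∀ z, (∏ h ∈ R, if h ∈ U.erase (G.facePerm (Sum.inl (δ₀, b))) then S h else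
          e h (Function.update a₀ (G.facePerm (Sum.inl (δ₀, b))) z h)) =
          ∏ h ∈ R, if h ∈ U then S h else e h (a₀ h) := by
        intro z
        refine Finset.prod_congr rfl fun h hh => ?_
        have hne := hRU h hh
        simp [hne]
      simp only [h1]
      rw [ENNReal.tsum_mul_left]
      gcongr
      have h2 : ∀ z, ∏ δ, G.lineBound J κ (U.erase (G.facePerm (Sum.inl (δ₀, b))))
          (Function.update a₀ (G.facePerm (Sum.inl (δ₀, b))) z) δ ≤
          G.lineBound J κ (U.erase (G.facePerm (Sum.inl (δ₀, b))))
          (Function.update a₀ (G.facePerm (Sum.inl (δ₀, b))) z) δ₀ *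
          ∏ δ ∈ Finset.univ.erase δ₀, G.lineBound J κ U a₀ δ := by
        intro z
        rw [← Finset.mul_prod_erase Finset.univ _ (Finset.mem_univ δ₀)]
        gcongr with δ
        exact lineBound_erase_le J κ hyU a₀ z δ
      refine (ENNReal.tsum_le_tsum h2).trans ?_
      rw [ENNReal.tsum_mul_right, ← Finset.mul_prod_erase Finset.univ _ (Finset.mem_univ δ₀)]
      gcongr
      exact tsum_lineBound_le hκ hxU hyU a₀

end RibbonGraph

open MeasureTheory

/-! ### Bounds on the propagator -/

/-- The binomial weight `C(m, p) y^p x^(m - p)`. -/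
def binomWeight (x y : ℝ) (m p : ℕ) : ℝ := (m.choose p : ℝ) * y ^ p * x ^ (m - p)

theorem binomWeight_nonneg {x y : ℝ} (hx : 0 ≤ x) (hy : 0 ≤ y) (m p : ℕ) :
    0 ≤ binomWeight x y m p := by unfold binomWeight; positivity

theorem sum_binomWeight (x y : ℝ) (m : ℕ) :
    ∑ p ∈ Finset.range (m + 1), binomWeight x y m p = (x + y) ^ m := by
  rw [add_comm x y, add_pow]
  exact Finset.sum_congr rfl fun p _ => by unfold binomWeight; ring

theorem binomWeight_le_one {x y : ℝ} (hx : 0 ≤ x) (hy : 0 ≤ y) (hxy : x + y ≤ 1) {m p : ℕ}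
    (hp : p ≤ m) : binomWeight x y m p ≤ 1 := by
  refine le_trans ?_ (pow_le_one₀ (add_nonneg hx hy) hxy (n := m))
  rw [← sum_binomWeight]
  exact Finset.single_le_sum (f := binomWeight x y m)
    (fun p _ => binomWeight_nonneg hx hy m p) (Finset.mem_range.2 (by omega))

/-- The majorant `∑_u √(C(m, m-u) y^(m-u) x^u) √(C(l, l-u) y^(l-u) x^u)` of the kernel. -/
def hopWeight (x y : ℝ) (m l : ℕ) : ℝ :=
  ∑ u ∈ Finset.range (m + 1), if u ≤ l then
    Real.sqrt (binomWeight x y m (m - u)) * Real.sqrt (binomWeight x y l (l - u)) else 0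

theorem hopWeight_nonneg (x y : ℝ) (m l : ℕ) : 0 ≤ hopWeight x y m l :=
  Finset.sum_nonneg fun u _ => by split_ifs <;> positivity

/-- The inequality of arithmetic and geometric means for `t * a` and `t⁻¹`. Taking `t = r ^ p` below
trades the square root for a tilted binomial weight plus a geometric term, both summable. -/
theorem sqrt_le_of_weight {a t : ℝ} (ha : 0 ≤ a) (ht : 0 < t) :
    Real.sqrt a ≤ (t * a + t⁻¹) / 2 := by
  rw [Real.sqrt_le_left (by positivity)]
  have h : t * t⁻¹ = 1 := mul_inv_cancel₀ ht.ne'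
  nlinarith [sq_nonneg (t * a - t⁻¹)]

theorem sqrt_binomWeight_le {x y r : ℝ} (hx : 0 ≤ x) (hy : 0 ≤ y) (hr : 1 < r) (m p : ℕ) :
    Real.sqrt (binomWeight x y m p) ≤ (binomWeight x (r * y) m p + (r⁻¹) ^ p) / 2 := by
  have hr0 : 0 < r := by linarith
  refine (sqrt_le_of_weight (binomWeight_nonneg hx hy m p) (pow_pos hr0 p)).trans (le_of_eq ?_)
  unfold binomWeight
  rw [mul_pow, inv_pow]
  ring

/-- The tilted weights sum to (x + r y)^m ≤ 1 by the binomial theorem, and the remaining terms form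
a geometric series, so the bound is independent of m. -/
theorem sum_sqrt_binomWeight_le {x y r : ℝ} (hx : 0 ≤ x) (hy : 0 ≤ y) (hr : 1 < r)
    (h : x + r * y ≤ 1) (m : ℕ) :
    ∑ u ∈ Finset.range (m + 1), Real.sqrt (binomWeight x y m (m - u)) ≤
      (1 + (1 - r⁻¹)⁻¹) / 2 := by
  have hr0 : 0 < r := by linarith
  have hr1 : r⁻¹ < 1 := inv_lt_one_of_one_lt₀ hr
  have h1 : ∑ u ∈ Finset.range (m + 1), Real.sqrt (binomWeight x y m (m - u)) =
      ∑ p ∈ Finset.range (m + 1), Real.sqrt (binomWeight x y m p) := by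
    rw [← Finset.sum_range_reflect (fun p => Real.sqrt (binomWeight x y m p)) (m + 1)]
    rfl
  rw [h1]
  refine (Finset.sum_le_sum fun p _ => sqrt_binomWeight_le hx hy hr m p).trans ?_
  rw [← Finset.sum_div, Finset.sum_add_distrib, sum_binomWeight]
  gcongr
  · exact pow_le_one₀ (by positivity) h
  · rw [← tsum_geometric_of_lt_one (by positivity) hr1]
    exact (summable_geometric_of_lt_one (by positivity) hr1).sum_le_tsum _
      (fun _ _ => by positivity)

/-- Here the upper binomial entry varies, and the negative binomial series gives x^u / (1 - r
y)^(u+1). The condition x ≤ 1 - r y makes this at most 1 / (1 - r y), uniformly in u. -/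
theorem tsum_sqrt_binomWeight_le {x y r d : ℝ} (hx : 0 ≤ x) (hy : 0 ≤ y) (hr : 1 < r)
    (hd : d < 1) (h : x + r * y ≤ 1) (h' : r * y ≤ d) (u : ℕ) :
    ∑' q : ℕ, ENNReal.ofReal (Real.sqrt (binomWeight x y (q + u) q)) ≤
      ENNReal.ofReal (((1 - d)⁻¹ + (1 - r⁻¹)⁻¹) / 2) := by
  have hr0 : 0 < r := by linarith
  have hr1 : r⁻¹ < 1 := inv_lt_one_of_one_lt₀ hr
  have hry : ‖r * y‖ < 1 := by
    rw [Real.norm_of_nonneg (by positivity)]; linarith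
  have s1 : HasSum (fun q : ℕ => binomWeight x (r * y) (q + u) q)
      (1 / (1 - r * y) ^ (u + 1) * x ^ u) := by
    have e : (fun q : ℕ => binomWeight x (r * y) (q + u) q) =
        fun q : ℕ => ((q + u).choose u : ℝ) * (r * y) ^ q * x ^ u := by
      funext q
      unfold binomWeight
      rw [Nat.add_sub_cancel_left, Nat.choose_symm_add]
    rw [e]
    exact (hasSum_choose_mul_geometric_of_norm_lt_one u hry).mul_right (x ^ u)
  have s2 := hasSum_geometric_of_lt_one (by positivity) hr1
  have s3 := (s1.add s2).div_const 2
  have hle : (1 / (1 - r * y) ^ (u + 1) * x ^ u + (1 - r⁻¹)⁻¹) / 2 ≤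
      ((1 - d)⁻¹ + (1 - r⁻¹)⁻¹) / 2 := by
    gcongr
    have hpos : 0 < 1 - r * y := by linarith
    have : 1 / (1 - r * y) ^ (u + 1) * x ^ u = (x / (1 - r * y)) ^ u * (1 - r * y)⁻¹ := by
      rw [div_pow, pow_succ]; field_simp
    rw [this]
    have hx1 : (x / (1 - r * y)) ^ u ≤ 1 :=
      pow_le_one₀ (by positivity) ((div_le_one hpos).2 (by linarith))
    calc _ ≤ 1 * (1 - r * y)⁻¹ := by gcongr
      _ ≤ _ := by rw [one_mul]; gcongr
  refine (ENNReal.tsum_le_tsum fun q => ENNReal.ofReal_le_ofReal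
    (sqrt_binomWeight_le hx hy hr (q + u) q)).trans ?_
  rw [← ENNReal.ofReal_tsum_of_nonneg (fun q => ?_) s3.summable, s3.tsum_eq]
  · exact ENNReal.ofReal_le_ofReal hle
  · have := binomWeight_nonneg hx (mul_nonneg hr0.le hy) (q + u) q
    positivity

/-- For fixed u the sum over l is bounded independently of u, so the double sum factors into the two
preceding estimates. -/
theorem tsum_hopWeight_le {x y r d : ℝ} (hx : 0 ≤ x) (hy : 0 ≤ y) (hr : 1 < r)
    (hd : d < 1) (h : x + r * y ≤ 1) (h' : r * y ≤ d) (m : ℕ) :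
    ∑' l : ℕ, ENNReal.ofReal (hopWeight x y m l) ≤
      ENNReal.ofReal ((1 + (1 - r⁻¹)⁻¹) / 2 * (((1 - d)⁻¹ + (1 - r⁻¹)⁻¹) / 2)) := by
  have hr1 : r⁻¹ < 1 := inv_lt_one_of_one_lt₀ hr
  have hr2 : 0 ≤ (1 - r⁻¹)⁻¹ := inv_nonneg.2 (by linarith)
  have e1 : ∀ l, ENNReal.ofReal (hopWeight x y m l) = ∑ u ∈ Finset.range (m + 1),
      if u ≤ l then ENNReal.ofReal (Real.sqrt (binomWeight x y m (m - u))) *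
        ENNReal.ofReal (Real.sqrt (binomWeight x y l (l - u))) else 0 := by
    intro l
    unfold hopWeight
    rw [ENNReal.ofReal_sum_of_nonneg (fun u _ => by split_ifs <;> positivity)]
    refine Finset.sum_congr rfl fun u _ => ?_
    split_ifs
    · rw [ENNReal.ofReal_mul (by positivity)]
    · simp
  simp only [e1]
  rw [Summable.tsum_finsetSum (fun _ _ => ENNReal.summable)]
  have e2 : ∀ u, (∑' l : ℕ, if u ≤ l then
      ENNReal.ofReal (Real.sqrt (binomWeight x y m (m - u))) *
        ENNReal.ofReal (Real.sqrt (binomWeight x y l (l - u))) else 0) ≤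
      ENNReal.ofReal (Real.sqrt (binomWeight x y m (m - u))) *
        ENNReal.ofReal (((1 - d)⁻¹ + (1 - r⁻¹)⁻¹) / 2) := by
    intro u
    have : (∑' l : ℕ, if u ≤ l then
      ENNReal.ofReal (Real.sqrt (binomWeight x y m (m - u))) *
        ENNReal.ofReal (Real.sqrt (binomWeight x y l (l - u))) else 0) =
      ∑' q : ℕ, ENNReal.ofReal (Real.sqrt (binomWeight x y m (m - u))) *
        ENNReal.ofReal (Real.sqrt (binomWeight x y (q + u) q)) := by
      rw [← (add_left_injective u).tsum_eq]
      · refine tsum_congr fun q => ?_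
        rw [if_pos (by omega), Nat.add_sub_cancel]
      · intro l hl
        by_contra hcon
        have hlt : ¬ u ≤ l := fun h => hcon ⟨l - u, Nat.sub_add_cancel h⟩
        exact hl (if_neg hlt)
    rw [this, ENNReal.tsum_mul_left]
    gcongr
    exact tsum_sqrt_binomWeight_le hx hy hr hd h h' u
  refine (Finset.sum_le_sum fun u _ => e2 u).trans ?_
  rw [← Finset.sum_mul, ENNReal.ofReal_mul (by positivity),
    ← ENNReal.ofReal_sum_of_nonneg (fun _ _ => by positivity)]
  gcongr
  exact sum_sqrt_binomWeight_le hx hy hr h m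

section Kernel

variable {Ω : ℝ} (hΩ₀ : 0 < Ω) (hΩ₁ : Ω < 1)

/-- The rate `(1 - Ω²) / (4 Ω)`. -/
def hopRate (Ω : ℝ) : ℝ := (1 - Ω ^ 2) / (4 * Ω)

/-- The contraction factor `e^{εα} √(1-α) / (1 + C α)`. -/
def stayFactor (Ω ε α : ℝ) : ℝ :=
  Real.exp (ε * α) * (Real.sqrt (1 - α) / (1 + constC Ω * α))

/-- The hopping factor `e^{εα} α (1-Ω²)/(4Ω) / (1 + C α)`. -/
def hopFactor (Ω ε α : ℝ) : ℝ :=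
  Real.exp (ε * α) * (hopRate Ω * α / (1 + constC Ω * α))

include hΩ₀ in
theorem constC_nonneg : 0 ≤ constC Ω := by unfold constC; positivity

include hΩ₀ hΩ₁ in
theorem hopRate_pos : 0 < hopRate Ω := by
  unfold hopRate
  have : 0 < 1 - Ω ^ 2 := by nlinarith
  positivity

include hΩ₀ in
theorem stayFactor_nonneg (ε : ℝ) {α : ℝ} (h0 : 0 ≤ α) : 0 ≤ stayFactor Ω ε α := by
  have := constC_nonneg hΩ₀
  unfold stayFactor; positivity

include hΩ₀ hΩ₁ in
theorem hopFactor_nonneg (ε : ℝ) {α : ℝ} (h0 : 0 ≤ α) : 0 ≤ hopFactor Ω ε α := by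
  have := constC_nonneg hΩ₀
  have := hopRate_pos hΩ₀ hΩ₁
  unfold hopFactor; positivity

-- The strict contraction comes from √(1-α) ≤ 1 - α/2 and `hopRate Ω` = 1/2 + C - Ω/2: at ε = 0 the
-- two factors add up to at most 1 - c₀ α. This linear margin absorbs a small ε. The bound `d` keeps
-- the hopping factor away from 1 even at α = 1.
include hΩ₀ hΩ₁ in
theorem exists_rate : ∃ ε d : ℝ, 0 < ε ∧ d < 1 ∧ ∀ α, 0 ≤ α → α ≤ 1 →
    stayFactor Ω ε α + Real.exp ε * hopFactor Ω ε α ≤ 1 ∧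
      Real.exp ε * hopFactor Ω ε α ≤ d := by
  have hC := constC_nonneg hΩ₀
  have hβ := hopRate_pos hΩ₀ hΩ₁
  have hβC : hopRate Ω < 1 + constC Ω := by
    unfold hopRate constC
    rw [← sub_pos]
    have : 1 + (1 - Ω) ^ 2 / (4 * Ω) - (1 - Ω ^ 2) / (4 * Ω) = (1 + Ω) / 2 := by
      field_simp; ring
    rw [this]; positivity
  set b := hopRate Ω / (1 + constC Ω) with hb
  have hb1 : b < 1 := by rw [hb, div_lt_one (by positivity)]; exact hβC
  have hb0 : 0 < b := by positivity
  set c₀ := Ω / (2 * (1 + constC Ω)) with hc₀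
  have hc₀p : 0 < c₀ := by positivity
  -- Half of the margin `c₀` pays for the extra factor e^ε on the hopping term, the other half for
  -- the factor e^{εα}. The condition `t2` keeps the hopping factor below the midpoint of `b` and 1.
  have t1 : ∀ᶠ ε in nhdsWithin (0 : ℝ) (Set.Ioi 0), (Real.exp ε - 1) * hopRate Ω < c₀ / 2 := by
    have : Filter.Tendsto (fun ε : ℝ => (Real.exp ε - 1) * hopRate Ω) (nhds 0) (nhds 0) := by
      have : Continuous (fun ε : ℝ => (Real.exp ε - 1) * hopRate Ω) := by fun_prop
      simpa using this.tendsto 0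
    exact (this.mono_left nhdsWithin_le_nhds).eventually_lt_const (by positivity)
  have t2 : ∀ᶠ ε in nhdsWithin (0 : ℝ) (Set.Ioi 0),
      Real.exp ε * (Real.exp ε * b) < (1 + b) / 2 := by
    have : Filter.Tendsto (fun ε : ℝ => Real.exp ε * (Real.exp ε * b)) (nhds 0) (nhds b) := by
      have : Continuous (fun ε : ℝ => Real.exp ε * (Real.exp ε * b)) := by fun_prop
      simpa using this.tendsto 0
    exact (this.mono_left nhdsWithin_le_nhds).eventually_lt_const (by linarith)
  have t3 : ∀ᶠ ε in nhdsWithin (0 : ℝ) (Set.Ioi 0), ε < c₀ / 2 :=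
    (Filter.tendsto_id.mono_left nhdsWithin_le_nhds).eventually_lt_const (by positivity)
  obtain ⟨ε, ⟨⟨h1, h2⟩, h3⟩, hε⟩ :=
    (((t1.and t2).and t3).and self_mem_nhdsWithin).exists
  have hε : 0 < ε := hε
  refine ⟨ε, (1 + b) / 2, hε, by linarith, fun α h0 h1' => ?_⟩
  have hden : 0 < 1 + constC Ω * α := by positivity
  have hexp : Real.exp (ε * α) ≤ Real.exp ε := Real.exp_le_exp.2 (by nlinarith)
  have hb' : hopRate Ω * α / (1 + constC Ω * α) ≤ b := by
    rw [hb, div_le_div_iff₀ hden (by positivity)]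
    nlinarith
  have hb'' : hopRate Ω * α / (1 + constC Ω * α) ≤ hopRate Ω * α :=
    div_le_self (by positivity) (by nlinarith)
  constructor
  · have hs : Real.sqrt (1 - α) ≤ 1 - α / 2 := by
      rw [Real.sqrt_le_left (by linarith)]; nlinarith
    have hAB : Real.sqrt (1 - α) / (1 + constC Ω * α) +
        hopRate Ω * α / (1 + constC Ω * α) ≤ 1 - c₀ * α := by
      rw [← add_div, div_le_iff₀ hden]
      have e1 : hopRate Ω = 1 / 2 + constC Ω - Ω / 2 := by
        unfold hopRate constC; field_simp; ring
      have e2 : c₀ * (1 + constC Ω * α) ≤ Ω / 2 := by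
        rw [hc₀, div_mul_eq_mul_div, div_le_iff₀ (by positivity)]
        nlinarith [mul_nonneg hΩ₀.le hC]
      nlinarith
    have hsum : Real.sqrt (1 - α) / (1 + constC Ω * α) +
        Real.exp ε * (hopRate Ω * α / (1 + constC Ω * α)) ≤ Real.exp (-(ε * α)) := by
      have e3 : (Real.exp ε - 1) * (hopRate Ω * α / (1 + constC Ω * α)) ≤ c₀ / 2 * α := by
        have : 0 ≤ Real.exp ε - 1 := by linarith [Real.add_one_le_exp ε]
        calc _ ≤ (Real.exp ε - 1) * (hopRate Ω * α) := by gcongr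
          _ ≤ _ := by nlinarith
      have e4 := Real.add_one_le_exp (-(ε * α))
      nlinarith
    have : stayFactor Ω ε α + Real.exp ε * hopFactor Ω ε α = Real.exp (ε * α) *
        (Real.sqrt (1 - α) / (1 + constC Ω * α) +
        Real.exp ε * (hopRate Ω * α / (1 + constC Ω * α))) := by
      unfold stayFactor hopFactor; ring
    rw [this]
    calc _ ≤ Real.exp (ε * α) * Real.exp (-(ε * α)) := by gcongr
      _ = 1 := by rw [← Real.exp_add]; simp
  · refine le_trans ?_ h2.le
    unfold hopFactor
    gcongr

theorem kernel_nonneg {Ω : ℝ} (hΩ₀ : 0 < Ω) (hΩ₁ : Ω < 1) {α : ℝ} (h0 : 0 ≤ α) (m n k l : ℕ) :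
    0 ≤ kernel Ω α m n k l := by
  have hC := constC_nonneg hΩ₀
  have : 0 ≤ 1 - Ω := by linarith
  unfold kernel
  split_ifs
  · positivity
  · exact le_rfl

/-- Put m = u+p, l = u+q, n = v+p, k = v+q. The four weights then carry y^{2(p+q)} x^{2(u+v)}, whose
square root is exactly the monomial on the left. -/
theorem sqrt_binomWeight_mul {x y : ℝ} (hx : 0 ≤ x) (hy : 0 ≤ y) {m n k l u : ℕ}
    (h : m + k = n + l) (hu : m - n ≤ u) (hm : u ≤ m) (hl : u ≤ l) :
    Real.sqrt ((m.choose (m - u) : ℝ) * (n.choose (m - u) : ℝ) *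
            (l.choose (l - u) : ℝ) * (k.choose (l - u) : ℝ)) *
          (y ^ ((m - u) + (l - u)) * x ^ (m + k - ((m - u) + (l - u)))) =
      Real.sqrt (binomWeight x y m (m - u)) * Real.sqrt (binomWeight x y n (m - u)) *
        Real.sqrt (binomWeight x y l (l - u)) * Real.sqrt (binomWeight x y k (l - u)) := by
  rw [← Real.sqrt_sq (show 0 ≤ y ^ ((m - u) + (l - u)) * x ^ (m + k - ((m - u) + (l - u))) by
    positivity), ← Real.sqrt_mul (by positivity),
    ← Real.sqrt_mul (binomWeight_nonneg hx hy ..),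
    ← Real.sqrt_mul (mul_nonneg (binomWeight_nonneg hx hy ..) (binomWeight_nonneg hx hy ..)),
    ← Real.sqrt_mul (mul_nonneg (mul_nonneg (binomWeight_nonneg hx hy ..)
      (binomWeight_nonneg hx hy ..)) (binomWeight_nonneg hx hy ..))]
  congr 1
  unfold binomWeight
  obtain ⟨p, rfl⟩ := Nat.exists_eq_add_of_le hm
  obtain ⟨q, rfl⟩ := Nat.exists_eq_add_of_le hl
  obtain ⟨v, rfl⟩ : ∃ v, n = v + p := ⟨n - p, by omega⟩
  obtain rfl : k = v + q := by omega
  have e1 : u + p - u = p := by omega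
  have e2 : u + q - u = q := by omega
  rw [e1, e2, show u + p + (v + q) - (p + q) = u + v by omega]
  simp only [Nat.add_sub_cancel]
  ring

/-- The kernel in terms of binomial weights. -/
theorem kernel_eq {Ω : ℝ} (hΩ₀ : 0 < Ω) (hΩ₁ : Ω < 1) (ε : ℝ) {α : ℝ} (h0 : 0 ≤ α) (h1 : α < 1)
    {m n k l : ℕ} (h : m + k = n + l) :
    kernel Ω α m n k l = Real.exp (-(ε * α * (m + k))) * ∑ u ∈ Finset.Icc (m - n) (min m l),
      Real.sqrt (binomWeight (stayFactor Ω ε α) (hopFactor Ω ε α) m (m - u)) *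
      Real.sqrt (binomWeight (stayFactor Ω ε α) (hopFactor Ω ε α) n (m - u)) *
      Real.sqrt (binomWeight (stayFactor Ω ε α) (hopFactor Ω ε α) l (l - u)) *
      Real.sqrt (binomWeight (stayFactor Ω ε α) (hopFactor Ω ε α) k (l - u)) := by
  have hC := constC_nonneg hΩ₀
  unfold kernel
  rw [if_pos h, Finset.mul_sum, Finset.mul_sum]
  refine Finset.sum_congr rfl fun u hu => ?_
  rw [Finset.mem_Icc, le_min_iff] at hu
  rw [← sqrt_binomWeight_mul (stayFactor_nonneg hΩ₀ ε h0) (hopFactor_nonneg hΩ₀ hΩ₁ ε h0) h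
    hu.1 hu.2.1 hu.2.2]
  set j := (m - u) + (l - u) with hj
  have hjle : j ≤ m + k := by omega
  obtain ⟨i, hi⟩ := Nat.exists_eq_add_of_le hjle
  have hs : 0 < Real.sqrt (1 - α) := Real.sqrt_pos.2 (by linarith)
  have hden : 0 < 1 + constC Ω * α := by positivity
  have hΩ1 : (0 : ℝ) < 1 - Ω := by linarith
  -- Each hop pairs one factor of the prefactor with one of the ratio; the square roots cancel
  -- because C(1+Ω) = `hopRate Ω` (1-Ω).
  have hX : Real.sqrt (1 - α) / (1 + constC Ω * α) *
      (constC Ω * α * (1 + Ω) / (Real.sqrt (1 - α) * (1 - Ω))) =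
      hopRate Ω * α / (1 + constC Ω * α) := by
    have : constC Ω * (1 + Ω) = hopRate Ω * (1 - Ω) := by
      unfold constC hopRate; field_simp; ring
    field_simp
    linear_combination α * this
  have hexp : Real.exp (-(ε * α * (m + k))) * Real.exp (ε * α) ^ (j + i) = 1 := by
    rw [← Real.exp_nat_mul, ← hi, ← Real.exp_add]
    push_cast
    ring_nf
    simp
  rw [hi, Nat.add_sub_cancel_left, stayFactor, hopFactor, ← hX, pow_add, mul_pow, mul_pow,
    mul_pow]
  rw [pow_add] at hexp
  linear_combination (-(√(1 - α) / (1 + constC Ω * α)) ^ j * (√(1 - α) / (1 + constC Ω * α)) ^ i * √(↑(m.choose (m - u)) * ↑(n.choose (m - u)) * ↑(l.choose (l - u)) * ↑(k.choose (l - u))) * (constC Ω * α * (1 + Ω) / (√(1 - α) * (1 - Ω))) ^ j) * hexp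

/-- Shifting u by k - l = n - m exchanges the exponents m - u and l - u. Through this symmetry a
bound along one strand of a line holds along the other too. -/
theorem kernel_swap (Ω α : ℝ) (m n k l : ℕ) :
    kernel Ω α m n k l = kernel Ω α k l m n := by
  unfold kernel
  by_cases h : m + k = n + l
  · rw [if_pos h, if_pos (by omega), add_comm k m]
    congr 1
    refine Finset.sum_nbij' (fun u => u + k - l) (fun u => u + l - k) ?_ ?_ ?_ ?_ ?_
    · intro u hu
      simp only [Finset.mem_Icc, le_min_iff] at hu ⊢
      omega
    · intro u hu
      simp only [Finset.mem_Icc, le_min_iff] at hu ⊢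
      omega
    · intro u hu
      simp only [Finset.mem_Icc, le_min_iff] at hu
      omega
    · intro u hu
      simp only [Finset.mem_Icc, le_min_iff] at hu
      omega
    · intro u hu
      simp only [Finset.mem_Icc, le_min_iff] at hu
      rw [show k - (u + k - l) = l - u by omega, show n - (u + k - l) = m - u by omega,
        add_comm (m - u)]
      congr 2
      ring
  · rw [if_neg h, if_neg (by omega)]

/-- The weights of n and k are at most 1 and are dropped, so the hopping part depends on one strand
only. Conservation rewrites m + k as half the sum of the four indices, so all four decay. -/
theorem kernel_le {Ω : ℝ} (hΩ₀ : 0 < Ω) (hΩ₁ : Ω < 1) {ε : ℝ} {α : ℝ} (h0 : 0 ≤ α) (h1 : α < 1)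
    (hε : 0 ≤ ε) (hle : stayFactor Ω ε α + Real.exp ε * hopFactor Ω ε α ≤ 1) (m n k l : ℕ) :
    kernel Ω α m n k l ≤ Real.exp (-(ε * α * (m + n + k + l) / 2)) *
      hopWeight (stayFactor Ω ε α) (hopFactor Ω ε α) m l := by
  by_cases h : m + k = n + l
  · have hx := stayFactor_nonneg hΩ₀ ε h0
    have hy := hopFactor_nonneg hΩ₀ hΩ₁ ε h0
    have hxy : stayFactor Ω ε α + hopFactor Ω ε α ≤ 1 := by
      have := Real.one_le_exp hε
      nlinarith
    rw [kernel_eq hΩ₀ hΩ₁ ε h0 h1 h]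
    have : ε * α * (m + k) = ε * α * (m + n + k + l) / 2 := by
      have : (m : ℝ) + k = n + l := by exact_mod_cast h
      linear_combination (ε * α / 2) * this
    rw [this]
    gcongr
    unfold hopWeight
    rw [← Finset.sum_filter]
    refine le_trans (Finset.sum_le_sum (g := fun u =>
      Real.sqrt (binomWeight (stayFactor Ω ε α) (hopFactor Ω ε α) m (m - u)) *
      Real.sqrt (binomWeight (stayFactor Ω ε α) (hopFactor Ω ε α) l (l - u))) fun u hu => ?_)
      (Finset.sum_le_sum_of_subset_of_nonneg (fun u hu => ?_) fun _ _ _ => by positivity)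
    · rw [Finset.mem_Icc, le_min_iff] at hu
      have a1 : Real.sqrt (binomWeight (stayFactor Ω ε α) (hopFactor Ω ε α) n (m - u)) ≤ 1 :=
        Real.sqrt_le_one.2 (binomWeight_le_one hx hy hxy (by omega))
      have a2 : Real.sqrt (binomWeight (stayFactor Ω ε α) (hopFactor Ω ε α) k (l - u)) ≤ 1 :=
        Real.sqrt_le_one.2 (binomWeight_le_one hx hy hxy (by omega))
      calc _ ≤ Real.sqrt (binomWeight (stayFactor Ω ε α) (hopFactor Ω ε α) m (m - u)) * 1 *
          Real.sqrt (binomWeight (stayFactor Ω ε α) (hopFactor Ω ε α) l (l - u)) * 1 := by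
            gcongr
        _ = _ := by ring
    · simp only [Finset.mem_Icc, le_min_iff] at hu
      simp only [Finset.mem_filter, Finset.mem_range]
      omega
  · rw [kernel, if_neg h]
    have := hopWeight_nonneg (stayFactor Ω ε α) (hopFactor Ω ε α) m l
    positivity

end Kernel

/-! ### Slices of the propagator and their majorants. -/

section Slices

variable {Ω θ μ₀ M : ℝ}

theorem measurable_kernel (Ω : ℝ) (m n k l : ℕ) : Measurable fun α => kernel Ω α m n k l := by
  unfold kernel
  split_ifs
  · fun_prop
  · fun_prop

theorem measurable_integrand (Ω θ μ₀ : ℝ) (m n k l : Index) :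
    Measurable (integrand Ω θ μ₀ m n k l) := by
  unfold integrand
  have := fun s => measurable_kernel Ω (m s) (n s) (k s) (l s)
  fun_prop

theorem measurable_hopWeight (Ω ε : ℝ) (m l : ℕ) :
    Measurable fun α => hopWeight (stayFactor Ω ε α) (hopFactor Ω ε α) m l := by
  unfold hopWeight binomWeight stayFactor hopFactor
  refine Finset.measurable_fun_sum _ fun u _ => ?_
  split_ifs
  · fun_prop
  · fun_prop

theorem integrand_nonneg (hΩ₀ : 0 < Ω) (hΩ₁ : Ω < 1) {α : ℝ} (h0 : 0 ≤ α) (h1 : α ≤ 1)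
    (m n k l : Index) : 0 ≤ integrand Ω θ μ₀ m n k l α := by
  have := constC_nonneg hΩ₀
  have h2 : 0 ≤ 1 - α := by linarith
  exact mul_nonneg (by positivity)
    (Finset.prod_nonneg fun s _ => kernel_nonneg hΩ₀ hΩ₁ h0 _ _ _ _)

theorem integrand_le (hΩ₀ : 0 < Ω) (hΩ₁ : Ω < 1) (hθ : 0 < θ) {ε : ℝ} {α : ℝ} (h0 : 0 ≤ α)
    (h1 : α < 1) (hε : 0 ≤ ε) (hle : stayFactor Ω ε α + Real.exp ε * hopFactor Ω ε α ≤ 1)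
    (m n k l : Index) :
    integrand Ω θ μ₀ m n k l α ≤
      Real.exp (-(ε * α * (m.size + n.size + k.size + l.size) / 2)) *
        ∏ s, hopWeight (stayFactor Ω ε α) (hopFactor Ω ε α) (m s) (l s) := by
  have hC := constC_nonneg hΩ₀
  have hpre : (1 - α) ^ (μ₀ ^ 2 * θ / (8 * Ω)) / (1 + constC Ω * α) ^ 2 ≤ 1 := by
    rw [div_le_one (by positivity)]
    calc _ ≤ (1 : ℝ) := Real.rpow_le_one (by linarith) (by linarith) (by positivity)
      _ ≤ _ := one_le_pow₀ (by nlinarith)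
  have hprod : ∏ s, kernel Ω α (m s) (n s) (k s) (l s) ≤
      ∏ s, (Real.exp (-(ε * α * (m s + n s + k s + l s) / 2)) *
        hopWeight (stayFactor Ω ε α) (hopFactor Ω ε α) (m s) (l s)) :=
    Finset.prod_le_prod (fun s _ => kernel_nonneg hΩ₀ hΩ₁ h0 _ _ _ _)
      fun s _ => kernel_le hΩ₀ hΩ₁ h0 h1 hε hle _ _ _ _
  rw [Finset.prod_mul_distrib, ← Real.exp_sum] at hprod
  have hexp : ∑ s, -(ε * α * ((m s : ℝ) + n s + k s + l s) / 2) =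
      -(ε * α * (m.size + n.size + k.size + l.size) / 2) := by
    simp only [Index.size, Fin.sum_univ_two]
    ring
  rw [hexp] at hprod
  unfold integrand
  refine le_trans ?_ hprod
  exact mul_le_of_le_one_left (Finset.prod_nonneg fun s _ => kernel_nonneg hΩ₀ hΩ₁ h0 _ _ _ _)
    hpre

theorem integrand_eq_zero {m n k l : Index} (h : m + k ≠ n + l) (α : ℝ) :
    integrand Ω θ μ₀ m n k l α = 0 := by
  obtain ⟨s, hs⟩ := Function.ne_iff.1 h
  unfold integrand
  rw [Finset.prod_eq_zero (Finset.mem_univ s) (if_neg hs), mul_zero]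

/-- A crude bound, not uniform in m, whose only role is to give integrability of the integrand. -/
theorem hopWeight_le {x y : ℝ} (hx : 0 ≤ x) (hy : 0 ≤ y) (hxy : x + y ≤ 1) (m l : ℕ) :
    hopWeight x y m l ≤ m + 1 := by
  unfold hopWeight
  refine (Finset.sum_le_sum (g := fun _ => (1 : ℝ)) fun u hu => ?_).trans (by simp)
  split_ifs
  · exact mul_le_one₀ (Real.sqrt_le_one.2 (binomWeight_le_one hx hy hxy (by omega)))
      (Real.sqrt_nonneg _) (Real.sqrt_le_one.2 (binomWeight_le_one hx hy hxy (by omega)))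
  · exact zero_le_one

theorem integrableOn_integrand (hΩ₀ : 0 < Ω) (hΩ₁ : Ω < 1) (hθ : 0 < θ) (m n k l : Index) :
    IntegrableOn (integrand Ω θ μ₀ m n k l) (Set.Ioc 0 1) := by
  obtain ⟨ε, d, hε, -, hrate⟩ := exists_rate hΩ₀ hΩ₁
  rw [integrableOn_Ioc_iff_integrableOn_Ioo]
  refine Measure.integrableOn_of_bounded (M := ∏ s, ((m s : ℝ) + 1)) (by simp)
    (measurable_integrand Ω θ μ₀ m n k l).aestronglyMeasurable ?_
  refine (ae_restrict_iff' measurableSet_Ioo).2 (Filter.Eventually.of_forall fun α hα => ?_)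
  have hx := stayFactor_nonneg hΩ₀ ε hα.1.le
  have hy := hopFactor_nonneg hΩ₀ hΩ₁ ε hα.1.le
  have hr := (hrate α hα.1.le hα.2.le).1
  rw [Real.norm_of_nonneg (integrand_nonneg hΩ₀ hΩ₁ hα.1.le hα.2.le ..)]
  refine (integrand_le hΩ₀ hΩ₁ hθ hα.1.le hα.2 hε.le hr m n k l).trans ?_
  have h1 : Real.exp (-(ε * α * (m.size + n.size + k.size + l.size) / 2)) ≤ 1 := by
    rw [Real.exp_le_one_iff]
    have := hα.1
    have : ∀ x : Index, 0 ≤ x.size := fun x => Finset.sum_nonneg fun _ _ => by positivity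
    have h4 := add_nonneg (add_nonneg (add_nonneg (this m) (this n)) (this k)) (this l)
    have : 0 ≤ ε * α * (m.size + n.size + k.size + l.size) / 2 := by positivity
    linarith
  calc _ ≤ 1 * ∏ s, hopWeight (stayFactor Ω ε α) (hopFactor Ω ε α) (m s) (l s) := by
        gcongr
        exact Finset.prod_nonneg fun s _ => hopWeight_nonneg _ _ _ _
    _ ≤ _ := by
        rw [one_mul]
        refine Finset.prod_le_prod (fun s _ => hopWeight_nonneg _ _ _ _) fun s _ =>
          hopWeight_le hx hy ?_ _ _
        have := Real.one_le_exp hε.le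
        nlinarith

theorem index_size_nonneg (x : Index) : 0 ≤ x.size := Finset.sum_nonneg fun _ _ => by positivity

/-- The interval `(M^{-i}, M^{-i+1}]` of the `i`-th slice. -/
def sliceSet (M : ℝ) (i : ℕ+) : Set ℝ :=
  Set.Ioc (M ^ (-((i : ℕ) : ℤ))) (M ^ (-((i : ℕ) : ℤ) + 1))

theorem sliceSet_subset (hM : 1 < M) (i : ℕ+) : sliceSet M i ⊆ Set.Ioc 0 1 := by
  intro α hα
  refine ⟨lt_trans (zpow_pos (by linarith) _) hα.1, hα.2.trans ?_⟩
  exact zpow_le_one_of_nonpos₀ hM.le (by have := i.pos; omega)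

theorem iUnion_sliceSet (hM : 1 < M) : ⋃ i, sliceSet M i = Set.Ioc 0 1 := by
  refine Set.Subset.antisymm (Set.iUnion_subset fun i => sliceSet_subset hM i) fun α hα => ?_
  obtain ⟨n, hn⟩ := exists_mem_Ioc_zpow hα.1 hM
  have hneg : n < 0 := by
    by_contra hcon
    exact absurd (hn.1.trans_le hα.2) (not_lt.2 (one_le_zpow₀ hM.le (by omega)))
  obtain ⟨i, hi⟩ : ∃ i : ℕ+, ((i : ℕ) : ℤ) = -n :=
    ⟨⟨(-n).toNat, by omega⟩, Int.toNat_of_nonneg (by omega)⟩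
  obtain rfl : n = -((i : ℕ) : ℤ) := by omega
  exact Set.mem_iUnion.2 ⟨i, hn⟩

theorem pairwise_disjoint_sliceSet (hM : 1 < M) :
    Pairwise (Function.onFun Disjoint (sliceSet M)) := by
  intro i j hij
  have hne : (-((i : ℕ) : ℤ)) ≠ -((j : ℕ) : ℤ) := by
    intro h
    exact hij (PNat.coe_injective (by omega))
  wlog hlt : (-((i : ℕ) : ℤ)) < -((j : ℕ) : ℤ) generalizing i j
  · exact (this hij.symm hne.symm (by omega)).symm
  refine Set.disjoint_left.2 fun α hα hα' => ?_
  have : M ^ (-((i : ℕ) : ℤ) + 1) ≤ M ^ (-((j : ℕ) : ℤ)) :=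
    zpow_le_zpow_right₀ hM.le (by omega)
  exact absurd (hα.2.trans this) (not_le.2 hα'.1)

theorem measurableSet_sliceSet (M : ℝ) (i : ℕ+) : MeasurableSet (sliceSet M i) :=
  measurableSet_Ioc

theorem zpow_slice_le (hM : 1 < M) (i : ℕ+) :
    M ^ (-((i : ℕ) : ℤ)) ≤ M ^ (-((i : ℕ) : ℤ) + 1) :=
  zpow_le_zpow_right₀ hM.le (by omega)

theorem ofReal_slicePropagator (hΩ₀ : 0 < Ω) (hΩ₁ : Ω < 1) (hθ : 0 < θ) (hM : 1 < M) (i : ℕ+)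
    (m n k l : Index) :
    ENNReal.ofReal (slicePropagator Ω θ μ₀ M i m n k l) = ENNReal.ofReal (θ / (8 * Ω)) *
      ∫⁻ α in sliceSet M i, ENNReal.ofReal (integrand Ω θ μ₀ m n k l α) := by
  unfold slicePropagator
  rw [ENNReal.ofReal_mul (by positivity), intervalIntegral.integral_of_le (zpow_slice_le hM i),
    ofReal_integral_eq_lintegral_ofReal]
  · rfl
  · exact (integrableOn_integrand hΩ₀ hΩ₁ hθ m n k l).mono_set (sliceSet_subset hM i)
  · refine (ae_restrict_iff' measurableSet_Ioc).2 (Filter.Eventually.of_forall fun α hα => ?_)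
    have := sliceSet_subset hM i hα
    exact integrand_nonneg hΩ₀ hΩ₁ this.1.le this.2 ..

theorem ofReal_propagator (hΩ₀ : 0 < Ω) (hΩ₁ : Ω < 1) (hθ : 0 < θ) (m n k l : Index) :
    ENNReal.ofReal (propagator Ω θ μ₀ m n k l) = ENNReal.ofReal (θ / (8 * Ω)) *
      ∫⁻ α in Set.Ioc 0 1, ENNReal.ofReal (integrand Ω θ μ₀ m n k l α) := by
  unfold propagator
  rw [ENNReal.ofReal_mul (by positivity), intervalIntegral.integral_of_le zero_le_one,
    ofReal_integral_eq_lintegral_ofReal]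
  · exact integrableOn_integrand hΩ₀ hΩ₁ hθ m n k l
  · refine (ae_restrict_iff' measurableSet_Ioc).2 (Filter.Eventually.of_forall fun α hα => ?_)
    exact integrand_nonneg hΩ₀ hΩ₁ hα.1.le hα.2 ..

/-- The propagator is the sum of its slices. -/
theorem ofReal_propagator_eq_tsum (hΩ₀ : 0 < Ω) (hΩ₁ : Ω < 1) (hθ : 0 < θ) (hM : 1 < M)
    (m n k l : Index) :
    ENNReal.ofReal (propagator Ω θ μ₀ m n k l) =
      ∑' i, ENNReal.ofReal (slicePropagator Ω θ μ₀ M i m n k l) := by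
  simp only [ofReal_propagator hΩ₀ hΩ₁ hθ, ofReal_slicePropagator hΩ₀ hΩ₁ hθ hM]
  rw [ENNReal.tsum_mul_left, ← iUnion_sliceSet hM,
    lintegral_iUnion (measurableSet_sliceSet M) (pairwise_disjoint_sliceSet hM)]

theorem propagator_nonneg (hΩ₀ : 0 < Ω) (hΩ₁ : Ω < 1) (hθ : 0 < θ) (m n k l : Index) :
    0 ≤ propagator Ω θ μ₀ m n k l :=
  mul_nonneg (by positivity) (intervalIntegral.integral_nonneg zero_le_one fun _ hα =>
    integrand_nonneg hΩ₀ hΩ₁ hα.1 hα.2 ..)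

theorem slicePropagator_nonneg (hΩ₀ : 0 < Ω) (hΩ₁ : Ω < 1) (hθ : 0 < θ) (hM : 1 < M) (i : ℕ+)
    (m n k l : Index) : 0 ≤ slicePropagator Ω θ μ₀ M i m n k l :=
  mul_nonneg (by positivity) (intervalIntegral.integral_nonneg (zpow_slice_le hM i) fun _ hα =>
    integrand_nonneg hΩ₀ hΩ₁ ((zpow_nonneg (by linarith) _).trans hα.1)
      (hα.2.trans (zpow_le_one_of_nonpos₀ hM.le (by have := i.pos; omega))) ..)

theorem slicePropagator_eq_zero (i : ℕ+) {m n k l : Index} (h : m + k ≠ n + l) :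
    slicePropagator Ω θ μ₀ M i m n k l = 0 := by
  unfold slicePropagator
  simp [integrand_eq_zero h]

theorem slicePropagator_swap (i : ℕ+) (m n k l : Index) :
    slicePropagator Ω θ μ₀ M i m n k l = slicePropagator Ω θ μ₀ M i k l m n := by
  unfold slicePropagator integrand
  simp only [kernel_swap Ω _ (m _) (n _) (k _) (l _)]

/-- The majorant of the `i`-th slice, which depends on the indices along one strand only. -/
def sliceMajorant (Ω θ ε M : ℝ) (i : ℕ+) (m l : Index) : ℝ≥0∞ :=
  ENNReal.ofReal (θ / (8 * Ω)) * ∫⁻ α in sliceSet M i,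
    ∏ s, ENNReal.ofReal (hopWeight (stayFactor Ω ε α) (hopFactor Ω ε α) (m s) (l s))

theorem ofReal_slicePropagator_le (hΩ₀ : 0 < Ω) (hΩ₁ : Ω < 1) (hθ : 0 < θ) (hM : 1 < M)
    {ε : ℝ} (hε : 0 < ε) (hle : ∀ α, 0 ≤ α → α ≤ 1 →
      stayFactor Ω ε α + Real.exp ε * hopFactor Ω ε α ≤ 1) (i : ℕ+) (m n k l : Index) :
    ENNReal.ofReal (slicePropagator Ω θ μ₀ M i m n k l) ≤
      ENNReal.ofReal (Real.exp (-(ε / 2 * M ^ (-((i : ℕ) : ℤ)) *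
        (m.size + n.size + k.size + l.size)))) * sliceMajorant Ω θ ε M i m l := by
  rw [ofReal_slicePropagator hΩ₀ hΩ₁ hθ hM, sliceMajorant, mul_left_comm]
  gcongr
  have hmeas : Measurable fun α => ∏ s, ENNReal.ofReal
      (hopWeight (stayFactor Ω ε α) (hopFactor Ω ε α) (m s) (l s)) :=
    Finset.measurable_fun_prod _ fun s _ =>
      ENNReal.measurable_ofReal.comp (measurable_hopWeight Ω ε (m s) (l s))
  rw [← lintegral_const_mul _ hmeas]
  refine lintegral_mono_ae ?_
  -- The first slice contains α = 1, where the ratio in the kernel divides by √(1-α) = 0 and the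
  -- pointwise bound is not available.
  have hne : ∀ᵐ α : ℝ ∂(volume.restrict (sliceSet M i)), α ≠ 1 := by
    refine ae_restrict_of_ae ?_
    simp [ae_iff]
  filter_upwards [hne, ae_restrict_mem (measurableSet_sliceSet M i)] with α hα1 hα
  have hα' := sliceSet_subset hM i hα
  rw [← ENNReal.ofReal_prod_of_nonneg (fun s _ => hopWeight_nonneg _ _ _ _),
    ← ENNReal.ofReal_mul (Real.exp_pos _).le]
  refine ENNReal.ofReal_le_ofReal ((integrand_le hΩ₀ hΩ₁ hθ hα'.1.le
    (lt_of_le_of_ne hα'.2 hα1) hε.le (hle α hα'.1.le hα'.2) m n k l).trans ?_)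
  gcongr
  · exact Finset.prod_nonneg fun s _ => hopWeight_nonneg _ _ _ _
  · have h4 := add_nonneg (add_nonneg (add_nonneg (index_size_nonneg m) (index_size_nonneg n))
      (index_size_nonneg k)) (index_size_nonneg l)
    have := hα.1.le
    have : ε * M ^ (-((i : ℕ) : ℤ)) * (m.size + n.size + k.size + l.size) ≤
      ε * α * (m.size + n.size + k.size + l.size) := by gcongr
    linarith

theorem tsum_sliceMajorant_le (hΩ₀ : 0 < Ω) (hΩ₁ : Ω < 1) (hθ : 0 < θ) (hM : 1 < M)
    {ε d : ℝ} (hε : 0 < ε) (hd : d < 1) (hle : ∀ α, 0 ≤ α → α ≤ 1 →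
      stayFactor Ω ε α + Real.exp ε * hopFactor Ω ε α ≤ 1 ∧
        Real.exp ε * hopFactor Ω ε α ≤ d) :
    ∃ κ : ℝ, 0 < κ ∧ ∀ (i : ℕ+) (m : Index),
      ∑' l, sliceMajorant Ω θ ε M i m l ≤ ENNReal.ofReal (κ * M ^ (-((i : ℕ) : ℤ))) := by
  -- The factor e^ε kept in front of the hopping factor in the rate condition is precisely the tilt
  -- r > 1 needed by the square-root sums.
  set r := Real.exp ε with hr
  have hr1 : 1 < r := Real.one_lt_exp_iff.2 hε
  have hM0 : 0 < M := by linarith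
  set κ₁ := (1 + (1 - r⁻¹)⁻¹) / 2 * (((1 - d)⁻¹ + (1 - r⁻¹)⁻¹) / 2) with hκ₁
  have hκ₁p : 0 < κ₁ := by
    have : 0 < 1 - r⁻¹ := sub_pos.2 (inv_lt_one_of_one_lt₀ hr1)
    have : 0 < 1 - d := sub_pos.2 hd
    positivity
  refine ⟨θ / (8 * Ω) * (κ₁ ^ 2 * (M - 1)), mul_pos (by positivity)
    (mul_pos (by positivity) (by linarith)), fun i m => ?_⟩
  have hmeas : ∀ l : Index, Measurable fun α => ∏ s, ENNReal.ofReal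
      (hopWeight (stayFactor Ω ε α) (hopFactor Ω ε α) (m s) (l s)) := fun l =>
    Finset.measurable_fun_prod _ fun s _ =>
      ENNReal.measurable_ofReal.comp (measurable_hopWeight Ω ε (m s) (l s))
  unfold sliceMajorant
  rw [ENNReal.tsum_mul_left, ← lintegral_tsum fun l => (hmeas l).aemeasurable, mul_assoc,
    ENNReal.ofReal_mul (by positivity)]
  gcongr
  calc ∫⁻ α in sliceSet M i, ∑' l : Index, ∏ s, ENNReal.ofReal
        (hopWeight (stayFactor Ω ε α) (hopFactor Ω ε α) (m s) (l s))
      ≤ ∫⁻ _ in sliceSet M i, ENNReal.ofReal (κ₁ ^ 2) := by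
        refine setLIntegral_mono measurable_const fun α hα => ?_
        have hα' := sliceSet_subset hM i hα
        rw [← ennreal_prod_tsum (fun (s : Fin 2) (l : ℕ) => ENNReal.ofReal
          (hopWeight (stayFactor Ω ε α) (hopFactor Ω ε α) (m s) l)), Fin.prod_univ_two, pow_two,
          ENNReal.ofReal_mul hκ₁p.le]
        have hx := stayFactor_nonneg hΩ₀ ε hα'.1.le
        have hy := hopFactor_nonneg hΩ₀ hΩ₁ ε hα'.1.le
        have hb := fun m : ℕ => tsum_hopWeight_le hx hy hr1 hd (hle α hα'.1.le hα'.2).1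
          (hle α hα'.1.le hα'.2).2 m
        exact mul_le_mul' (hb _) (hb _)
    _ = ENNReal.ofReal (κ₁ ^ 2 * (M - 1) * M ^ (-((i : ℕ) : ℤ))) := by
        rw [setLIntegral_const, sliceSet, Real.volume_Ioc, ← ENNReal.ofReal_mul (by positivity),
          zpow_add_one₀ hM0.ne']
        congr 1
        ring

/-- Geometric sum over one index. -/
theorem tsum_exp_size_le {c : ℝ} (hc : 0 < c) (hM : 1 < M) (i : ℕ+) :
    ∑' z : Index, ENNReal.ofReal (Real.exp (-c * M ^ (-((i : ℕ) : ℤ)) * z.size)) ≤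
      ENNReal.ofReal ((1 + c) ^ 2 / c ^ 2 * M ^ (2 * ((i : ℕ) : ℤ))) := by
  have hM0 : 0 < M := by linarith
  set t := c * M ^ (-((i : ℕ) : ℤ)) with ht
  have ht0 : 0 < t := by positivity
  have htc : t ≤ c := by
    have : M ^ (-((i : ℕ) : ℤ)) ≤ 1 := zpow_le_one_of_nonpos₀ hM.le (by omega)
    nlinarith
  have e1 : ∀ z : Index, ENNReal.ofReal (Real.exp (-c * M ^ (-((i : ℕ) : ℤ)) * z.size)) =
      ∏ s, ENNReal.ofReal (Real.exp (-t) ^ (z s)) := by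
    intro z
    rw [← ENNReal.ofReal_prod_of_nonneg (fun _ _ => by positivity)]
    congr 1
    simp only [← Real.exp_nat_mul, ← Real.exp_sum, Index.size, Fin.sum_univ_two]
    congr 1
    rw [ht]; ring
  have hq : Real.exp (-t) < 1 := Real.exp_zero ▸ Real.exp_lt_exp.2 (by linarith)
  simp only [e1]
  rw [← ennreal_prod_tsum (fun (_ : Fin 2) (z : ℕ) => ENNReal.ofReal (Real.exp (-t) ^ z)),
    Finset.prod_const, Finset.card_univ, Fintype.card_fin,
    ← ENNReal.ofReal_tsum_of_nonneg (fun _ => by positivity)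
      (summable_geometric_of_lt_one (Real.exp_pos _).le hq),
    tsum_geometric_of_lt_one (Real.exp_pos _).le hq, ← ENNReal.ofReal_pow (by
      rw [inv_nonneg]; linarith)]
  refine ENNReal.ofReal_le_ofReal ?_
  -- The geometric sum is thus at most (1 + t)/t, and t ≤ c allows 1 + c in the numerator; squaring
  -- for the two components gives M^{2i}.
  have h1 : t / (1 + t) ≤ 1 - Real.exp (-t) := by
    have : Real.exp (-t) ≤ (1 + t)⁻¹ := by
      rw [Real.exp_neg]
      exact inv_anti₀ (by positivity) (by linarith [Real.add_one_le_exp t])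
    have h2 : t / (1 + t) = 1 - (1 + t)⁻¹ := by field_simp; ring
    linarith
  have h2 : (1 - Real.exp (-t))⁻¹ ≤ (1 + c) / t := by
    calc _ ≤ (t / (1 + t))⁻¹ := inv_anti₀ (by positivity) h1
      _ = (1 + t) / t := inv_div _ _
      _ ≤ _ := by gcongr
  calc _ ≤ ((1 + c) / t) ^ 2 := by
        have : 0 ≤ (1 - Real.exp (-t))⁻¹ := by rw [inv_nonneg]; linarith
        gcongr
    _ = _ := by
        rw [ht, zpow_neg, two_mul, zpow_add₀ hM0.ne']
        field_simp

end Slices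

/-- Estimates are made in `ℝ≥0∞`, where sums always exist and commute; this brings them back to real
series. -/
theorem summable_and_tsum_le_of_ofReal {ι : Type*} {f : ι → ℝ} (hf : ∀ i, 0 ≤ f i) {B : ℝ}
    (hB : 0 ≤ B) (h : ∑' i, ENNReal.ofReal (f i) ≤ ENNReal.ofReal B) :
    Summable f ∧ ∑' i, f i ≤ B := by
  have hs : Summable f := by
    have := ENNReal.summable_toReal (ne_top_of_le_ne_top ENNReal.ofReal_ne_top h)
    simpa only [ENNReal.toReal_ofReal (hf _)] using this
  refine ⟨hs, ?_⟩
  rwa [← ENNReal.ofReal_tsum_of_nonneg hf hs, ENNReal.ofReal_le_ofReal_iff hB] at h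

theorem prod_zpow_eq_zpow_sum {ι : Type*} (s : Finset ι) (f : ι → ℤ) {x : ℝ} (hx : x ≠ 0) :
    ∏ i ∈ s, x ^ f i = x ^ ∑ i ∈ s, f i := by
  classical
  induction s using Finset.induction_on with
  | empty => simp
  | insert i s hi ih => rw [Finset.prod_insert hi, Finset.sum_insert hi, zpow_add₀ hx, ih]

/-! ### Internal faces, reference corners and the bound at fixed scales. -/

namespace RibbonGraph

variable {L E : Type*} (G : RibbonGraph L E)

instance [Finite L] [Finite E] : Finite G.Face := by unfold Face; infer_instance

instance [Finite L] [Finite E] : Finite G.Vertex := by unfold Vertex; infer_instance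

/-- The internal faces. -/
abbrev InternalFace : Type _ := {f : G.Face // ¬ G.IsExternal f}

theorem faceOf_eq_iff {h h' : HalfEdge L E} :
    G.faceOf h = G.faceOf h' ↔ G.facePerm.SameCycle h h' := Quotient.eq

theorem card_internalFace [Finite L] [Finite E] :
    Nat.card G.InternalFace + G.numExternalFaces = G.numFaces := by
  rw [add_comm, numExternalFaces, numFaces, ← Nat.card_sum]
  classical
  exact Nat.card_congr (Equiv.sumCompl G.IsExternal)

theorem exists_attached {f : G.Face} (hf : ¬ G.IsExternal f) : ∃ δ, G.Attached f δ := by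
  obtain ⟨h, rfl⟩ := Quotient.exists_rep f
  obtain ⟨δ, b⟩ | j := h
  · exact ⟨δ, b, rfl⟩
  · exact absurd ⟨j, rfl⟩ hf

variable [Fintype L]

theorem exists_isSmallestAt (o : Fin (Fintype.card L) ≃ L) (f : G.InternalFace) :
    ∃ δ, G.IsSmallestAt o f.1 δ := by
  obtain ⟨δ, hδ, hmin⟩ := Set.exists_min_image {δ | G.Attached f.1 δ} o.symm (Set.toFinite _)
    (G.exists_attached f.2)
  exact ⟨δ, hδ, hmin⟩

/-- The smallest line attached to an internal face. -/
def smallestLine (o : Fin (Fintype.card L) ≃ L) (f : G.InternalFace) : L :=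
  (G.exists_isSmallestAt o f).choose

theorem smallestLine_spec (o : Fin (Fintype.card L) ≃ L) (f : G.InternalFace) :
    G.IsSmallestAt o f.1 (G.smallestLine o f) := (G.exists_isSmallestAt o f).choose_spec

theorem isSmallestAt_iff (o : Fin (Fintype.card L) ≃ L) (f : G.InternalFace) (δ : L) :
    G.IsSmallestAt o f.1 δ ↔ G.smallestLine o f = δ := by
  constructor
  · intro h
    have h' := G.smallestLine_spec o f
    exact o.symm.injective (le_antisymm (h'.2 _ h.1) (h.2 _ h'.1))
  · rintro rfl
    exact G.smallestLine_spec o f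

theorem mainMult_eq (o : Fin (Fintype.card L) ≃ L) (δ : L) :
    G.mainMult o δ = Nat.card {f : G.InternalFace // G.smallestLine o f = δ} :=
  Nat.card_congr
    { toFun := fun f => ⟨⟨f.1, f.2.1⟩, (G.isSmallestAt_iff o ⟨f.1, f.2.1⟩ δ).1 f.2.2⟩
      invFun := fun f => ⟨f.1.1, f.1.2, (G.isSmallestAt_iff o f.1 δ).2 f.2⟩
      left_inv := fun _ => rfl
      right_inv := fun _ => rfl }

theorem sum_mainMult_mul [Finite E] [Fintype G.InternalFace] (o : Fin (Fintype.card L) ≃ L)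
    (g : L → ℤ) :
    ∑ δ, (G.mainMult o δ : ℤ) * g δ = ∑ f : G.InternalFace, g (G.smallestLine o f) := by
  classical
  rw [← Finset.sum_fiberwise Finset.univ (G.smallestLine o)]
  refine Finset.sum_congr rfl fun δ _ => ?_
  rw [Finset.sum_congr rfl (g := fun _ => g δ) fun f hf => by
    rw [(Finset.mem_filter.1 hf).2], Finset.sum_const, nsmul_eq_mul, mainMult_eq,
    Nat.card_eq_fintype_card, Fintype.card_subtype]

/-- An end of the smallest line of an internal face at which the face starts. -/
def refEnd (o : Fin (Fintype.card L) ≃ L) (f : G.InternalFace) : Bool :=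
  (G.smallestLine_spec o f).1.choose

/-- The reference corner of an internal face, on a strand of its smallest line. -/
def refCorner (o : Fin (Fintype.card L) ≃ L) (f : G.InternalFace) : HalfEdge L E :=
  Sum.inl (G.smallestLine o f, G.refEnd o f)

theorem faceOf_refCorner (o : Fin (Fintype.card L) ≃ L) (f : G.InternalFace) :
    G.faceOf (G.refCorner o f) = f.1 := (G.smallestLine_spec o f).1.choose_spec

theorem refCorner_injective (o : Fin (Fintype.card L) ≃ L) :
    Function.Injective (G.refCorner o) := fun f f' h =>
  Subtype.ext (by rw [← G.faceOf_refCorner o f, ← G.faceOf_refCorner o f', h])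

/-- Distinct internal faces have distinct reference corners, each an end of a line. This lets
constants attached to faces be absorbed into a power of the number of lines. -/
theorem card_internalFace_le [Finite E] : Nat.card G.InternalFace ≤ 2 * Fintype.card L := by
  have o := (Fintype.equivFin L).symm
  have := Nat.card_le_card_of_injective
    (fun f : G.InternalFace => (G.smallestLine o f, G.refEnd o f))
    (fun f f' h => G.refCorner_injective o (congrArg Sum.inl h))
  simpa [mul_comm] using this

omit [Fintype L] in
theorem legDecay_pos (M c : ℝ) (μ : L → ℕ+) (x : Index) (h : HalfEdge L E) :
    0 < legDecay M c μ x h := by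
  obtain ⟨δ, b⟩ | j := h
  · exact Real.exp_pos _
  · exact one_pos

omit [Fintype L] in
theorem legDecay_le_one {M c : ℝ} (hM : 1 < M) (hc : 0 < c) (μ : L → ℕ+) (x : Index)
    (h : HalfEdge L E) : legDecay M c μ x h ≤ 1 := by
  obtain ⟨δ, b⟩ | j := h
  · rw [legDecay, Real.exp_le_one_iff]
    have := index_size_nonneg x
    have : 0 ≤ c * M ^ (-((μ δ : ℕ) : ℤ)) * x.size := by positivity
    linarith
  · exact le_rfl

variable [Fintype E]

theorem scaleBound_nonneg {M K c : ℝ} (hM : 1 < M) (hK : 0 < K) (hc : 0 < c)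
    (o : Fin (Fintype.card L) ≃ L) (μ : L → ℕ+) (m n : E → Index) :
    0 ≤ G.scaleBound M K c o μ m n := by
  have h1 := Finset.prod_nonneg (s := Finset.univ) (f := fun j =>
    legDecay M c μ (m j) (G.rot.symm (Sum.inr j))) fun j _ => (legDecay_pos ..).le
  have h2 := Finset.prod_nonneg (s := Finset.univ) (f := fun j =>
    legDecay M c μ (n j) (G.rot (Sum.inr j))) fun j _ => (legDecay_pos ..).le
  unfold scaleBound
  positivity

/-- The product of the exponential decays of all lines dominates the decays of the external
indices and of the reference corners. -/
theorem prod_exp_le {M c : ℝ} (hM : 1 < M) (hc : 0 < c) (μ : L → ℕ+) {m n : E → Index}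
    (a : G.Assignment m n) (R : Finset (HalfEdge L E)) :
    ∏ δ, Real.exp (-(2 * c * M ^ (-((μ δ : ℕ) : ℤ)) * ((a.1 (Sum.inl (δ, true))).size +
      (a.1 (G.rot (Sum.inl (δ, true)))).size + (a.1 (Sum.inl (δ, false))).size +
      (a.1 (G.rot (Sum.inl (δ, false)))).size))) ≤
    (∏ j, legDecay M c μ (m j) (G.rot.symm (Sum.inr j))) *
      (∏ j, legDecay M c μ (n j) (G.rot (Sum.inr j))) *
      ∏ h ∈ R, legDecay M c μ (a.1 h) h := by
  classical
  -- `P₁` and `P₂` give each half-edge the decay of the index on its one side and on its other side.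
  -- Rate 2c provides two copies of each: `P₂` serves the m indices, one `P₁` the n indices, the
  -- other `P₁` the reference corners, and the spare `P₂` is bounded by 1. Hence a corner shared by
  -- two roles is never charged twice.
  set P₁ := ∏ h : HalfEdge L E, legDecay M c μ (a.1 h) h with hP₁
  set P₂ := ∏ h : HalfEdge L E, legDecay M c μ (a.1 (G.rot h)) h with hP₂
  have hpos := fun x h => legDecay_pos (E := E) M c μ x h
  have hle := fun x h => legDecay_le_one (E := E) hM hc μ x h
  have e : ∏ δ, Real.exp (-(2 * c * M ^ (-((μ δ : ℕ) : ℤ)) * ((a.1 (Sum.inl (δ, true))).size +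
      (a.1 (G.rot (Sum.inl (δ, true)))).size + (a.1 (Sum.inl (δ, false))).size +
      (a.1 (G.rot (Sum.inl (δ, false)))).size))) = (P₁ * P₂) ^ 2 := by
    rw [hP₁, hP₂, Fintype.prod_sum_type, Fintype.prod_sum_type, Fintype.prod_prod_type,
      Fintype.prod_prod_type]
    simp only [legDecay, Finset.prod_const_one, mul_one, Fintype.prod_bool]
    rw [← Finset.prod_mul_distrib, ← Finset.prod_pow]
    refine Finset.prod_congr rfl fun δ _ => ?_
    rw [← Real.exp_add, ← Real.exp_add, ← Real.exp_add, ← Real.exp_nat_mul]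
    congr 1
    push_cast
    ring
  have h0 : ∀ (S : Finset (HalfEdge L E)) (x : HalfEdge L E → Index),
      ∏ h, legDecay M c μ (x h) h ≤ ∏ h ∈ S, legDecay M c μ (x h) h := fun S x =>
    Finset.prod_le_prod_of_subset_of_le_one (Finset.subset_univ S)
      (fun h _ => (hpos _ h).le) fun h _ _ => hle _ h
  have h1 : P₁ ≤ ∏ h ∈ R, legDecay M c μ (a.1 h) h := h0 R a.1
  have h2 : P₁ ≤ ∏ j, legDecay M c μ (n j) (G.rot (Sum.inr j)) := by
    have := h0 (Finset.univ.map ⟨fun j : E => G.rot (Sum.inr j),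
      G.rot.injective.comp Sum.inr_injective⟩) a.1
    rw [Finset.prod_map] at this
    refine this.trans (le_of_eq (Finset.prod_congr rfl fun j _ => ?_))
    rw [← (a.2 j).2]; rfl
  have h3 : P₂ ≤ ∏ j, legDecay M c μ (m j) (G.rot.symm (Sum.inr j)) := by
    have := h0 (Finset.univ.map ⟨fun j : E => G.rot.symm (Sum.inr j),
      G.rot.symm.injective.comp Sum.inr_injective⟩) (fun h => a.1 (G.rot h))
    rw [Finset.prod_map] at this
    refine this.trans (le_of_eq (Finset.prod_congr rfl fun j _ => ?_))
    rw [← (a.2 j).1]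
    simp
  have h4 : P₂ ≤ 1 := Finset.prod_le_one (fun h _ => (hpos _ h).le) fun h _ => hle _ h
  have p1 : 0 ≤ P₁ := Finset.prod_nonneg fun h _ => (hpos _ h).le
  have p2 : 0 ≤ P₂ := Finset.prod_nonneg fun h _ => (hpos _ h).le
  rw [e]
  calc (P₁ * P₂) ^ 2 = P₂ * P₁ * P₁ * P₂ := by ring
    _ ≤ (∏ j, legDecay M c μ (m j) (G.rot.symm (Sum.inr j))) *
      (∏ j, legDecay M c μ (n j) (G.rot (Sum.inr j))) *
      (∏ h ∈ R, legDecay M c μ (a.1 h) h) * 1 := by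
        have := p1.trans h1
        have := p1.trans h2
        have := p2.trans h3
        gcongr
    _ = _ := mul_one _

omit [Fintype E] in
theorem sliceTerm_nonneg {Ω θ μ₀ M : ℝ} (hΩ₀ : 0 < Ω) (hΩ₁ : Ω < 1) (hθ : 0 < θ) (hM : 1 < M)
    (μ : L → ℕ+) (m n : E → Index) (a : G.Assignment m n) :
    0 ≤ G.sliceTerm Ω θ μ₀ M μ m n a :=
  Finset.prod_nonneg fun _ _ => slicePropagator_nonneg hΩ₀ hΩ₁ hθ hM _ _ _ _ _

/-- The sum over all index assignments when the slices have a majorant that is summable along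
every strand. -/
theorem tsum_sliceTerm_le {Ω θ μ₀ M ε κ : ℝ} (hΩ₀ : 0 < Ω) (hΩ₁ : Ω < 1) (hθ : 0 < θ)
    (hM : 1 < M) (hε : 0 < ε) (hκ : 0 < κ)
    (hle : ∀ α, 0 ≤ α → α ≤ 1 → stayFactor Ω ε α + Real.exp ε * hopFactor Ω ε α ≤ 1)
    (hJ : ∀ (i : ℕ+) (m : Index),
      ∑' l, sliceMajorant Ω θ ε M i m l ≤ ENNReal.ofReal (κ * M ^ (-((i : ℕ) : ℤ))))
    (o : Fin (Fintype.card L) ≃ L) (μ : L → ℕ+) (m n : E → Index) :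
    ∑' a, ENNReal.ofReal (G.sliceTerm Ω θ μ₀ M μ m n a) ≤
      ENNReal.ofReal (G.scaleBound M (κ * (1 + ε / 4) ^ 4) (ε / 4) o μ m n) := by
  classical
  -- A corner between two legs may receive contradictory external indices, and then the sum is
  -- empty. Otherwise `a₀` records the values at the known corners.
  rcases isEmpty_or_nonempty (G.Assignment m n) with hemp | ⟨⟨a₀⟩⟩
  · simp
  have hM0 : 0 < M := by linarith
  set c := ε / 4 with hc
  have hc0 : 0 < c := by positivity
  have := Fintype.ofFinite G.InternalFace
  set J : L → Index → Index → ℝ≥0∞ := fun δ => sliceMajorant Ω θ ε M (μ δ) with hJdef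
  set w : L → Index → Index → Index → Index → ℝ≥0∞ := fun δ m n k l =>
    if m + k = n + l then J δ m l ⊓ J δ k n else 0 with hw
  set R : Finset (HalfEdge L E) := Finset.univ.map ⟨G.refCorner o, G.refCorner_injective o⟩
    with hR
  set e : HalfEdge L E → Index → ℝ≥0∞ := fun h z => ENNReal.ofReal (legDecay M c μ z h) with he
  set S : HalfEdge L E → ℝ≥0∞ := Sum.elim
    (fun p => ENNReal.ofReal ((1 + c) ^ 2 / c ^ 2 * M ^ (2 * ((μ p.1 : ℕ) : ℤ)))) (fun _ => 0)
    with hS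
  -- The unknown corners are those not touching any leg.
  set U : Finset (HalfEdge L E) := Finset.univ.filter
    (fun h => ∀ j : E, h ≠ Sum.inr j ∧ h ≠ G.rot (Sum.inr j)) with hU
  set leg : ℝ := (∏ j, legDecay M c μ (m j) (G.rot.symm (Sum.inr j))) *
      (∏ j, legDecay M c μ (n j) (G.rot (Sum.inr j))) with hleg
  have hleg0 : 0 ≤ leg := mul_nonneg (Finset.prod_nonneg fun j _ => (legDecay_pos ..).le)
    (Finset.prod_nonneg fun j _ => (legDecay_pos ..).le)
  have hslice : ∀ δ m n k l, ENNReal.ofReal (slicePropagator Ω θ μ₀ M (μ δ) m n k l) ≤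
      ENNReal.ofReal (Real.exp (-(2 * c * M ^ (-((μ δ : ℕ) : ℤ)) *
        (m.size + n.size + k.size + l.size)))) * w δ m n k l := by
    intro δ m n k l
    have h2c : 2 * c = ε / 2 := by rw [hc]; ring
    simp only [hw]
    split_ifs with h
    · rw [h2c]
      rcases le_total (J δ m l) (J δ k n) with h' | h'
      · rw [inf_eq_left.2 h']
        exact ofReal_slicePropagator_le hΩ₀ hΩ₁ hθ hM hε hle (μ δ) m n k l
      · rw [inf_eq_right.2 h', slicePropagator_swap]
        refine (ofReal_slicePropagator_le hΩ₀ hΩ₁ hθ hM hε hle (μ δ) k l m n).trans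
          (le_of_eq ?_)
        congr 3
        ring_nf
    · rw [slicePropagator_eq_zero _ h]; simp
  have hterm : ∀ a : G.Assignment m n, ENNReal.ofReal (G.sliceTerm Ω θ μ₀ M μ m n a) ≤
      ENNReal.ofReal leg * ((∏ h ∈ R, e h (a.1 h)) * ∏ δ, w δ (a.1 (Sum.inl (δ, true)))
            (a.1 (G.rot (Sum.inl (δ, true)))) (a.1 (Sum.inl (δ, false)))
            (a.1 (G.rot (Sum.inl (δ, false))))) := by
    intro a
    unfold sliceTerm weight
    rw [ENNReal.ofReal_prod_of_nonneg fun δ _ =>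
      slicePropagator_nonneg hΩ₀ hΩ₁ hθ hM _ _ _ _ _]
    refine (Finset.prod_le_prod' fun δ _ => hslice δ _ _ _ _).trans ?_
    rw [Finset.prod_mul_distrib, ← mul_assoc]
    gcongr
    rw [← ENNReal.ofReal_prod_of_nonneg fun δ _ => (Real.exp_pos _).le, he,
      ← ENNReal.ofReal_prod_of_nonneg fun h _ => (legDecay_pos ..).le,
      ← ENNReal.ofReal_mul hleg0]
    exact ENNReal.ofReal_le_ofReal (G.prod_exp_le hM hc0 μ a R)
  have hRU : ∀ h ∈ R, h ∈ U := by
    intro h hh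
    obtain ⟨f, -, rfl⟩ := Finset.mem_map.1 hh
    refine Finset.mem_filter.2 ⟨Finset.mem_univ _, fun j => ⟨Sum.inl_ne_inr, fun hj => f.2 ⟨j, ?_⟩⟩⟩
    rw [← G.faceOf_refCorner o f]
    refine (G.faceOf_eq_iff).2 ⟨1, ?_⟩
    rw [zpow_one]
    exact hj.symm
  have hinj : ∑' a : G.Assignment m n, ((∏ h ∈ R, e h (a.1 h)) *
      ∏ δ, w δ (a.1 (Sum.inl (δ, true))) (a.1 (G.rot (Sum.inl (δ, true))))
        (a.1 (Sum.inl (δ, false))) (a.1 (G.rot (Sum.inl (δ, false))))) ≤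
      ∑' a : {a : HalfEdge L E → Index // ∀ h, h ∉ U → a h = a₀.1 h},
        (∏ h ∈ R, e h (a.1 h)) * ∏ δ, w δ (a.1 (Sum.inl (δ, true)))
          (a.1 (G.rot (Sum.inl (δ, true)))) (a.1 (Sum.inl (δ, false)))
          (a.1 (G.rot (Sum.inl (δ, false)))) := by
    let φ : G.Assignment m n → {a : HalfEdge L E → Index // ∀ h, h ∉ U → a h = a₀.1 h} :=
      fun a => ⟨a.1, fun h hh => by
        simp only [hU, Finset.mem_filter, Finset.mem_univ, true_and, not_forall,
          not_and_or, not_not] at hh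
        obtain ⟨j, rfl | rfl⟩ := hh
        · rw [(a.2 j).1, (a₀.2 j).1]
        · rw [(a.2 j).2, (a₀.2 j).2]⟩
    have hφ : Function.Injective φ := fun a a' h => Subtype.ext (congrArg (fun x => x.1) h)
    exact ENNReal.tsum_comp_le_tsum_of_injective hφ (fun a => (∏ h ∈ R, e h (a.1 h)) *
      ∏ δ, w δ (a.1 (Sum.inl (δ, true))) (a.1 (G.rot (Sum.inl (δ, true))))
        (a.1 (Sum.inl (δ, false))) (a.1 (G.rot (Sum.inl (δ, false)))))
  have hmain := tsum_corners_le (G := G) (J := J)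
    (κ := fun δ => ENNReal.ofReal (κ * M ^ (-((μ δ : ℕ) : ℤ)))) (fun δ m => hJ (μ δ) m) (w := w)
    (fun δ m n k l => by simp only [hw]; split_ifs; exacts [inf_le_left, zero_le])
    (fun δ m n k l => by simp only [hw]; split_ifs; exacts [inf_le_right, zero_le])
    (fun δ m n k l h => if_neg h) R (e := e) (S := S) (by
      intro h hh
      obtain ⟨f, -, rfl⟩ := Finset.mem_map.1 hh
      exact tsum_exp_size_le hc0 hM (μ (G.smallestLine o f))) U
    (fun j h => ((Finset.mem_filter.1 h).2 j).2 rfl) (by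
      intro h
      by_cases hext : G.IsExternal (G.faceOf h)
      · obtain ⟨j, hj⟩ := hext
        obtain ⟨N, hN⟩ := ((G.faceOf_eq_iff).1 hj).exists_nat_pow_eq
        exact ⟨Sum.inr j, Or.inl fun h => ((Finset.mem_filter.1 h).2 j).1 rfl, N, hN⟩
      · obtain ⟨N, hN⟩ :=
          ((G.faceOf_eq_iff).1 (G.faceOf_refCorner o ⟨_, hext⟩)).exists_nat_pow_eq
        exact ⟨_, Or.inr (Finset.mem_map_of_mem _ (Finset.mem_univ _)), N, hN⟩) a₀.1
  refine (ENNReal.tsum_le_tsum hterm).trans ?_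
  rw [ENNReal.tsum_mul_left]
  refine (mul_le_mul_right (hinj.trans hmain) _).trans ?_
  have hfin : (∏ h ∈ R, if h ∈ U then S h else e h (a₀.1 h)) *
      ∏ δ, G.lineBound J (fun δ => ENNReal.ofReal (κ * M ^ (-((μ δ : ℕ) : ℤ)))) U a₀.1 δ ≤
      ENNReal.ofReal ((∏ f : G.InternalFace, ((1 + c) ^ 2 / c ^ 2 *
        M ^ (2 * ((μ (G.smallestLine o f) : ℕ) : ℤ)))) *
        ∏ δ, (κ * M ^ (-((μ δ : ℕ) : ℤ)))) := by
    rw [ENNReal.ofReal_mul (Finset.prod_nonneg fun _ _ => by positivity),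
      ENNReal.ofReal_prod_of_nonneg (fun _ _ => by positivity),
      ENNReal.ofReal_prod_of_nonneg (fun _ _ => by positivity)]
    refine mul_le_mul' (le_of_eq ?_) (Finset.prod_le_prod' fun δ _ => lineBound_le_const ..)
    rw [Finset.prod_congr rfl (g := S) fun h hh => if_pos (hRU h hh), hR, Finset.prod_map]
    rfl
  refine (mul_le_mul_right hfin _).trans ?_
  rw [← ENNReal.ofReal_mul hleg0]
  refine ENNReal.ofReal_le_ofReal ?_
  have hcard : Nat.card G.InternalFace = G.numFaces - G.numExternalFaces := by
    have := G.card_internalFace; omega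
  have hprod1 : ∏ f : G.InternalFace, ((1 + c) ^ 2 / c ^ 2 *
        M ^ (2 * ((μ (G.smallestLine o f) : ℕ) : ℤ))) =
      (1 + c) ^ (2 * Nat.card G.InternalFace) / c ^ (2 * (G.numFaces - G.numExternalFaces)) *
        M ^ (2 * ∑ δ, (G.mainMult o δ : ℤ) * ((μ δ : ℕ) : ℤ)) := by
    rw [Finset.prod_mul_distrib, Finset.prod_const, Finset.card_univ, div_pow, ← pow_mul,
      ← pow_mul, ← hcard, Nat.card_eq_fintype_card, sum_mainMult_mul, Finset.mul_sum,
      prod_zpow_eq_zpow_sum _ _ hM0.ne']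
  have hprod2 : ∏ δ, (κ * M ^ (-((μ δ : ℕ) : ℤ))) =
      κ ^ Fintype.card L * M ^ (-∑ δ, ((μ δ : ℕ) : ℤ)) := by
    rw [Finset.prod_mul_distrib, Finset.prod_const, Finset.card_univ, ← Finset.sum_neg_distrib,
      prod_zpow_eq_zpow_sum _ _ hM0.ne']
  -- Each internal face contributes (1 + c)^2 and there are at most two such faces per line, whence
  -- the exponent 4 in the constant.
  have hpow : (1 + c) ^ (2 * Nat.card G.InternalFace) * κ ^ Fintype.card L ≤
      (κ * (1 + c) ^ 4) ^ G.numLines := by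
    rw [numLines, Nat.card_eq_fintype_card (α := L), mul_pow, ← pow_mul, mul_comm]
    refine mul_le_mul_of_nonneg_left (pow_le_pow_right₀ (by linarith) ?_) (by positivity)
    have := G.card_internalFace_le
    omega
  rw [hprod1, hprod2]
  unfold scaleBound
  calc _ = (1 + c) ^ (2 * Nat.card G.InternalFace) * κ ^ Fintype.card L /
        c ^ (2 * (G.numFaces - G.numExternalFaces)) * M ^ (-∑ δ, ((μ δ : ℕ) : ℤ)) *
        M ^ (2 * ∑ δ, (G.mainMult o δ : ℤ) * ((μ δ : ℕ) : ℤ)) * leg := by ring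
    _ ≤ (κ * (1 + c) ^ 4) ^ G.numLines / c ^ (2 * (G.numFaces - G.numExternalFaces)) *
        M ^ (-∑ δ, ((μ δ : ℕ) : ℤ)) *
        M ^ (2 * ∑ δ, (G.mainMult o δ : ℤ) * ((μ δ : ℕ) : ℤ)) * leg := by gcongr
    _ = _ := by rw [hleg]; ring

end RibbonGraph

/-! ### Summation by layers and geometric sums over scales. -/

/-- Summation by layers: if all upper tail sums of the weights are negative, then a monotone
sequence of natural numbers has a weighted sum of at most minus its maximum. -/
theorem sum_mul_le_neg_of_tail {N : ℕ} {x : Fin N → ℕ} (hx : Monotone x) {w : Fin N → ℤ}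
    (hw : ∀ γ, ∑ k ∈ Finset.univ.filter (fun k => γ ≤ k), w k ≤ -1) (k₀ : Fin N) :
    ∑ k, w k * (x k : ℤ) ≤ -(x k₀ : ℤ) := by
  obtain ⟨k₁, -, hk₁⟩ := Finset.exists_max_image Finset.univ x ⟨k₀, Finset.mem_univ _⟩
  have h1 : ∀ k, w k * (x k : ℤ) =
      ∑ t ∈ Finset.range (x k₁), if t < x k then w k else 0 := by
    intro k
    rw [← Finset.sum_filter, Finset.sum_const, nsmul_eq_mul, mul_comm]
    congr 2
    have : (Finset.range (x k₁)).filter (fun t => t < x k) = Finset.range (x k) := by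
      ext t
      have := hk₁ k (Finset.mem_univ _)
      simp only [Finset.mem_filter, Finset.mem_range]
      omega
    rw [this, Finset.card_range]
  simp only [h1]
  rw [Finset.sum_comm]
  -- By monotonicity, the indices whose value exceeds t form an upper tail, nonempty because t is
  -- below the maximum; each of the `x k₁` layers contributes at most -1.
  have h2 : ∀ t ∈ Finset.range (x k₁), (∑ k, if t < x k then w k else 0) ≤ -1 := by
    intro t ht
    rw [Finset.mem_range] at ht
    obtain ⟨γ, hγ, hmin⟩ := Finset.exists_min_image (Finset.univ.filter fun k => t < x k) id
      ⟨k₁, by simpa using ht⟩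
    rw [← Finset.sum_filter]
    convert hw γ using 3 with k
    have hγ' : t < x γ := by simpa using hγ
    exact ⟨fun h => hmin k (by simpa using h), fun h => hγ'.trans_le (hx h)⟩
  refine (Finset.sum_le_sum h2).trans ?_
  have := hk₁ k₀ (Finset.mem_univ _)
  simp only [Finset.sum_const, Finset.card_range, nsmul_eq_mul]
  omega

theorem summable_prod_pow {L : Type*} [Fintype L] {r : ℝ} (h0 : 0 ≤ r) (h1 : r < 1) :
    Summable fun μ : L → ℕ+ => ∏ δ, r ^ (μ δ : ℕ) := by
  have hs : Summable fun k : ℕ+ => r ^ (k : ℕ) :=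
    (summable_geometric_of_lt_one h0 h1).comp_injective PNat.coe_injective
  refine (summable_and_tsum_le_of_ofReal (B := ∏ _δ : L, ∑' k : ℕ+, r ^ (k : ℕ))
    (fun μ => by positivity)
    (Finset.prod_nonneg fun _ _ => tsum_nonneg fun _ => by positivity) ?_).1
  rw [ENNReal.ofReal_prod_of_nonneg fun _ _ => tsum_nonneg fun _ => by positivity]
  simp only [ENNReal.ofReal_tsum_of_nonneg (fun k : ℕ+ => pow_nonneg h0 (k : ℕ)) hs]
  rw [ennreal_prod_tsum]
  refine le_of_eq (tsum_congr fun μ => ?_)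
  rw [ENNReal.ofReal_prod_of_nonneg fun _ _ => by positivity]

namespace RibbonGraph

variable {L E : Type*} (G : RibbonGraph L E)

/-! ### The Euler relation -/

variable {G} in
theorem IsPhi4.pow_ne (hG : G.IsPhi4) (h : HalfEdge L E) {i : ℕ} (h0 : 0 < i) (h4 : i < 4) :
    (G.rot ^ i) h ≠ h := by
  intro hi
  refine (hG h).2 ?_
  have h2 := (hG h).1
  interval_cases i
  · rw [pow_one] at hi
    rw [pow_two, Equiv.Perm.mul_apply, hi, hi]
  · exact hi
  · have : G.rot h = h := by
      rwa [pow_succ', Equiv.Perm.mul_apply, hi] at h2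
    rw [pow_two, Equiv.Perm.mul_apply, this, this]

-- `rot ^ 4 = 1` and `rot ^ 2` has no fixed point, so every cycle has exactly four elements; a
-- chosen representative of each vertex and its rotations list all half-edges.
variable {G} in
theorem IsPhi4.card_halfEdge (hG : G.IsPhi4) :
    Nat.card (HalfEdge L E) = 4 * G.numVertices := by
  have hpow : G.rot ^ 4 = 1 := Equiv.ext fun h => (hG h).1
  let φ : G.Vertex × Fin 4 → HalfEdge L E := fun p => (G.rot ^ (p.2 : ℕ)) (Quotient.out p.1)
  have hφ : ∀ p, (Quotient.mk _ (φ p) : G.Vertex) = p.1 := fun p =>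
    (Quotient.sound (s := Equiv.Perm.SameCycle.setoid G.rot)
      (Equiv.Perm.sameCycle_pow_left.2 (Equiv.Perm.SameCycle.refl _ _))).trans
      (Quotient.out_eq p.1)
  have hinj : Function.Injective φ := by
    rintro ⟨v, i⟩ ⟨v', j⟩ h
    have hv : v = v' := (hφ (v, i)).symm.trans ((congrArg (Quotient.mk _) h).trans (hφ (v', j)))
    subst hv
    wlog hij : i ≤ j generalizing i j
    · exact (this j i h.symm (le_of_not_ge hij)).symm
    rcases hij.eq_or_lt with rfl | hlt
    · rfl
    · exfalso
      have hlt' : (i : ℕ) < j := hlt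
      refine hG.pow_ne (φ (v, i)) (i := j - i) (by omega) (by omega) ?_
      rw [h]
      change (G.rot ^ ((j : ℕ) - i)) ((G.rot ^ (j : ℕ)) (Quotient.out v)) = _
      have h' : (G.rot ^ (j : ℕ)) (Quotient.out v) = (G.rot ^ (i : ℕ)) (Quotient.out v) := h.symm
      rw [h', ← Equiv.Perm.mul_apply, ← pow_add, Nat.sub_add_cancel hlt'.le]
  have hsurj : Function.Surjective φ := by
    intro h
    have : G.rot.SameCycle (Quotient.out (Quotient.mk _ h : G.Vertex)) h :=
      Quotient.exact (Quotient.out_eq (Quotient.mk _ h : G.Vertex))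
    obtain ⟨n, hn⟩ := this
    refine ⟨(Quotient.mk _ h, ⟨(n % 4).toNat, by omega⟩), ?_⟩
    change (G.rot ^ (n % 4).toNat) _ = h
    rw [← zpow_natCast, Int.toNat_of_nonneg (by omega)]
    nth_rw 2 [← hn]
    congr 1
    exact (zpow_eq_zpow_emod n (by exact_mod_cast hpow)).symm
  rw [← Nat.card_congr (Equiv.ofBijective φ ⟨hinj, hsurj⟩), Nat.card_prod, Nat.card_fin, mul_comm]
  rfl

/-- With the genus given by its Euler formula, this is linear algebra over 2I + N = 4V.
Connectedness plays no part, so it applies to the subgraphs as well. -/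
theorem omega_eq_of_isPhi4 [Finite L] [Finite E] (hG : G.IsPhi4) :
    (G.omega : ℚ) =
      (2 - (G.numLegs : ℚ) / 2) - 2 * (2 * G.genus + G.numExternalFaces - 1) := by
  have h := hG.card_halfEdge
  rw [Nat.card_sum, Nat.card_prod, Nat.card_eq_fintype_card (α := Bool), Fintype.card_bool] at h
  have h' : (G.numLines : ℚ) * 2 + G.numLegs = 4 * G.numVertices := by exact_mod_cast h
  unfold omega genus
  push_cast
  linear_combination (1 / 2 : ℚ) * h'

theorem omega_eq_card [Finite L] [Finite E] :
    G.omega = 2 * (Nat.card G.InternalFace : ℤ) - Nat.card L := by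
  have := G.card_internalFace
  unfold omega numLines
  omega

/-! ### Faces of subgraphs -/

variable (S : Finset L)

/-- The half-edge of the whole graph given by a half-edge of a subgraph. -/
def subVal (h : HalfEdge {δ // δ ∈ S} (G.SubLeg S)) : HalfEdge L E := (G.subIncl S h).1

theorem subVal_injective : Function.Injective (G.subVal S) :=
  Subtype.val_injective.comp (G.subIncl_bijective S).1

theorem subVal_rot (h : HalfEdge {δ // δ ∈ S} (G.SubLeg S)) :
    G.subVal S ((G.sub S).rot h) = G.rot (G.subVal S h) := by
  have := Equiv.apply_symm_apply (Equiv.ofBijective _ (G.subIncl_bijective S))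
    ((G.rot.subtypePerm fun h => G.inSub_rot S h) (G.subIncl S h))
  exact congrArg Subtype.val this

theorem subVal_rot_pow (n : ℕ) (h : HalfEdge {δ // δ ∈ S} (G.SubLeg S)) :
    G.subVal S (((G.sub S).rot ^ n) h) = (G.rot ^ n) (G.subVal S h) := by
  induction n with
  | zero => rfl
  | succ n ih => rw [pow_succ', pow_succ', Equiv.Perm.mul_apply, subVal_rot, ih]; rfl

variable {G} in
theorem IsPhi4.sub (hG : G.IsPhi4) : (G.sub S).IsPhi4 := by
  intro h
  constructor
  · apply G.subVal_injective S
    rw [subVal_rot_pow]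
    exact (hG _).1
  · intro hh
    refine (hG (G.subVal S h)).2 ?_
    rw [← subVal_rot_pow, hh]

theorem subVal_facePerm_inl (δ : {δ // δ ∈ S}) (b : Bool) :
    G.subVal S ((G.sub S).facePerm (Sum.inl (δ, b))) = G.facePerm (Sum.inl (δ.1, b)) := by
  rw [facePerm_inl, subVal_rot]
  rfl

/-- The two face permutations agree at the ends of lines of `S`; they can differ only at legs of the
subgraph, which an internal face never meets. -/
theorem subVal_facePerm_pow [Finite L] [Finite E] {h : HalfEdge {δ // δ ∈ S} (G.SubLeg S)}
    (hh : ¬ (G.sub S).IsExternal ((G.sub S).faceOf h)) (n : ℕ) :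
    G.subVal S (((G.sub S).facePerm ^ n) h) = (G.facePerm ^ n) (G.subVal S h) := by
  induction n with
  | zero => rfl
  | succ n ih =>
    rw [pow_succ', pow_succ', Equiv.Perm.mul_apply, Equiv.Perm.mul_apply, ← ih]
    rcases hx : ((G.sub S).facePerm ^ n) h with ⟨δ, b⟩ | j
    · rw [subVal_facePerm_inl]
      rfl
    · refine absurd ⟨j, ?_⟩ hh
      rw [faceOf_eq_iff, ← hx]
      exact Equiv.Perm.sameCycle_pow_left.2 (Equiv.Perm.SameCycle.refl _ _)

theorem exists_subVal_of_faceOf_eq [Finite L] [Finite E]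
    {h : HalfEdge {δ // δ ∈ S} (G.SubLeg S)}
    (hh : ¬ (G.sub S).IsExternal ((G.sub S).faceOf h)) {x : HalfEdge L E}
    (hx : G.faceOf (G.subVal S h) = G.faceOf x) :
    ∃ (δ : {δ // δ ∈ S}) (b : Bool), x = Sum.inl (δ.1, b) ∧
      (G.sub S).faceOf h = (G.sub S).faceOf (Sum.inl (δ, b)) := by
  obtain ⟨n, hn⟩ := ((G.faceOf_eq_iff).1 hx).exists_nat_pow_eq
  rw [← subVal_facePerm_pow G S hh] at hn
  have hcyc : (G.sub S).faceOf h = (G.sub S).faceOf (((G.sub S).facePerm ^ n) h) :=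
    ((G.sub S).faceOf_eq_iff).2 (Equiv.Perm.sameCycle_pow_right.2 (Equiv.Perm.SameCycle.refl _ _))
  rcases hy : ((G.sub S).facePerm ^ n) h with ⟨δ, b⟩ | j
  · rw [hy] at hn hcyc
    exact ⟨δ, b, hn.symm, hcyc⟩
  · rw [hy] at hcyc
    exact absurd ⟨j, hcyc.symm⟩ hh

/-- The internal faces of a subgraph are the internal faces of the graph all of whose attached
lines belong to the subgraph. -/
theorem card_internalFace_sub [Finite L] [Finite E] :
    Nat.card (G.sub S).InternalFace =
      Nat.card {f : G.InternalFace // ∀ δ, G.Attached f.1 δ → δ ∈ S} := by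
  have hout : ∀ f : (G.sub S).InternalFace,
      (G.sub S).faceOf (Quotient.out f.1) = f.1 := fun f => Quotient.out_eq f.1
  have hint : ∀ f : (G.sub S).InternalFace,
      ¬ (G.sub S).IsExternal ((G.sub S).faceOf (Quotient.out f.1)) := fun f => by
    rw [hout]; exact f.2
  let φ : (G.sub S).InternalFace → {f : G.InternalFace // ∀ δ, G.Attached f.1 δ → δ ∈ S} :=
    fun f => ⟨⟨G.faceOf (G.subVal S (Quotient.out f.1)), by
      rintro ⟨j, hj⟩
      obtain ⟨δ, b, h, -⟩ := G.exists_subVal_of_faceOf_eq S (hint f) hj.symm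
      exact Sum.inr_ne_inl h⟩, by
      rintro δ ⟨b, hδ⟩
      obtain ⟨δ', b', h, -⟩ := G.exists_subVal_of_faceOf_eq S (hint f) hδ.symm
      obtain ⟨rfl, rfl⟩ := Prod.mk.inj (Sum.inl.inj h)
      exact δ'.2⟩
  refine Nat.card_congr (Equiv.ofBijective φ ⟨fun f f' h => ?_, fun f => ?_⟩)
  · have h1 : G.faceOf (G.subVal S (Quotient.out f.1)) =
        G.faceOf (G.subVal S (Quotient.out f'.1)) := congrArg (fun x => x.1.1) h
    obtain ⟨δ, b, h2, h3⟩ := G.exists_subVal_of_faceOf_eq S (hint f) h1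
    have h4 : Quotient.out f'.1 = Sum.inl (δ, b) := G.subVal_injective S h2
    apply Subtype.ext
    rw [← hout f, h3, ← h4, hout f']
  · obtain ⟨⟨f, hf⟩, hS⟩ := f
    obtain ⟨δ, b, hδ⟩ := G.exists_attached hf
    let h : HalfEdge {δ // δ ∈ S} (G.SubLeg S) := Sum.inl (⟨δ, hS δ ⟨b, hδ⟩⟩, b)
    -- Conversely, a face of the whole graph all of whose lines lie in `S` never passes through a
    -- leg of the subgraph, so its orbit lifts step by step.
    have key : ∀ n : ℕ, ∃ δ' b', ((G.sub S).facePerm ^ n) h = Sum.inl (δ', b') ∧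
        G.subVal S (((G.sub S).facePerm ^ n) h) = (G.facePerm ^ n) (Sum.inl (δ, b)) := by
      intro n
      induction n with
      | zero => exact ⟨_, _, rfl, rfl⟩
      | succ n ih =>
        obtain ⟨δ', b', h1, h2⟩ := ih
        have h3 : G.subVal S (((G.sub S).facePerm ^ (n + 1)) h) =
            (G.facePerm ^ (n + 1)) (Sum.inl (δ, b)) := by
          rw [pow_succ', pow_succ', Equiv.Perm.mul_apply, Equiv.Perm.mul_apply, ← h2, h1,
            subVal_facePerm_inl]
          rfl
        have h4 : G.faceOf ((G.facePerm ^ (n + 1)) (Sum.inl (δ, b))) = f := by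
          rw [← hδ, faceOf_eq_iff]
          exact Equiv.Perm.sameCycle_pow_left.2 (Equiv.Perm.SameCycle.refl _ _)
        rcases hy : (G.facePerm ^ (n + 1)) (Sum.inl (δ, b)) with ⟨δ'', b''⟩ | j
        · rw [hy] at h3 h4
          exact ⟨⟨δ'', hS δ'' ⟨b'', h4⟩⟩, b'', G.subVal_injective S h3, h3⟩
        · rw [hy] at h4
          exact absurd ⟨j, h4⟩ hf
    have hinth : ¬ (G.sub S).IsExternal ((G.sub S).faceOf h) := by
      rintro ⟨j, hj⟩
      obtain ⟨n, hn⟩ := (((G.sub S).faceOf_eq_iff).1 hj.symm).exists_nat_pow_eq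
      obtain ⟨δ', b', h1, -⟩ := key n
      exact Sum.inr_ne_inl (hn.symm.trans h1)
    refine ⟨⟨_, hinth⟩, Subtype.ext (Subtype.ext ?_)⟩
    change G.faceOf (G.subVal S (Quotient.out ((G.sub S).faceOf h))) = f
    obtain ⟨n, hn⟩ := (((G.sub S).faceOf_eq_iff).1
      (hout ⟨_, hinth⟩).symm).exists_nat_pow_eq
    obtain ⟨-, -, -, h2⟩ := key n
    change ((G.sub S).facePerm ^ n) h = Quotient.out ((G.sub S).faceOf h) at hn
    rw [← hn, h2, ← hδ, faceOf_eq_iff]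
    exact Equiv.Perm.sameCycle_pow_left.2 (Equiv.Perm.SameCycle.refl _ _)

/-! ### Power counting -/

variable [Fintype L]

/-- The lines of the subgraph `G_γ`. -/
theorem mem_highLines (o : Fin (Fintype.card L) ≃ L) (γ : Fin (Fintype.card L)) (δ : L) :
    δ ∈ (Finset.univ.filter fun γ' => γ ≤ γ').map o.toEmbedding ↔ γ ≤ o.symm δ := by
  simp only [Finset.mem_map_equiv, Finset.mem_filter, Finset.mem_univ, true_and]

/-- All lines attached to a face are at least γ in the order exactly when its smallest line is;
counting internal faces of the subgraph by smallest line gives the tail sum. -/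
theorem omega_highSub [Finite E] (o : Fin (Fintype.card L) ≃ L) (γ : Fin (Fintype.card L)) :
    (G.highSub o γ).omega =
      ∑ k ∈ Finset.univ.filter (fun k => γ ≤ k), (2 * (G.mainMult o (o k) : ℤ) - 1) := by
  classical
  have := Fintype.ofFinite G.InternalFace
  unfold highSub
  rw [omega_eq_card, card_internalFace_sub, Finset.sum_sub_distrib, ← Finset.mul_sum]
  congr 1
  · congr 1
    have h1 := G.sum_mainMult_mul o (fun δ => if γ ≤ o.symm δ then 1 else 0)
    simp only [mul_ite, mul_one, mul_zero] at h1
    rw [← Equiv.sum_comp o] at h1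
    simp only [Equiv.symm_apply_apply] at h1
    rw [Finset.sum_filter, h1, Finset.sum_boole, Nat.card_eq_fintype_card, Fintype.card_subtype]
    congr 2
    ext f
    simp only [Finset.mem_filter, Finset.mem_univ, true_and, mem_highLines]
    have hs := G.smallestLine_spec o f
    exact ⟨fun h => h _ hs.1, fun h δ hδ => h.trans (hs.2 δ hδ)⟩
  · rw [Nat.card_eq_fintype_card, Fintype.card_coe, Finset.card_map]
    simp

theorem omega_highSub_zero [Finite E] (o : Fin (Fintype.card L) ≃ L)
    (γ : Fin (Fintype.card L)) (hγ : (γ : ℕ) = 0) : (G.highSub o γ).omega = G.omega := by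
  have hall : ∀ δ, δ ∈ (Finset.univ.filter fun γ' => γ ≤ γ').map o.toEmbedding := fun δ => by
    rw [mem_highLines, Fin.le_def, hγ]
    exact Nat.zero_le _
  unfold highSub
  rw [omega_eq_card, omega_eq_card, card_internalFace_sub]
  congr 2
  · congr 1
    exact Nat.card_congr (Equiv.subtypeUnivEquiv fun f δ _ => hall δ)
  · exact Nat.card_congr (Equiv.subtypeUnivEquiv hall)

theorem exponent_le [Finite E] {o : Fin (Fintype.card L) ≃ L}
    (ho : ∀ γ, (G.highSub o γ).omega < 0) {μ : L → ℕ+} (hμ : IsScaleOrder μ o) (δ : L) :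
    -∑ δ, ((μ δ : ℕ) : ℤ) + 2 * ∑ δ, (G.mainMult o δ : ℤ) * ((μ δ : ℕ) : ℤ) ≤ -((μ δ : ℕ) : ℤ) := by
  have h := sum_mul_le_neg_of_tail (x := fun k => (μ (o k) : ℕ)) (fun k k' hk => hμ hk)
    (w := fun k => 2 * (G.mainMult o (o k) : ℤ) - 1) (fun γ => by
      have := ho γ
      rw [omega_highSub] at this
      omega) (o.symm δ)
  rw [Equiv.apply_symm_apply] at h
  refine le_trans (le_of_eq ?_) h
  rw [Equiv.sum_comp o fun δ => (2 * (G.mainMult o δ : ℤ) - 1) * ((μ δ : ℕ) : ℤ), Finset.mul_sum,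
    ← Finset.sum_neg_distrib, ← Finset.sum_add_distrib]
  exact Finset.sum_congr rfl fun δ _ => by ring

variable [Fintype E]

/-- If all high-scale subgraphs have negative degree, the bound decays geometrically in every
scale. -/
theorem exists_scaleBound_le {M K c : ℝ} (hM : 1 < M) (hK : 0 < K) (hc : 0 < c) :
    ∃ A r : ℝ, 0 ≤ r ∧ r < 1 ∧ ∀ (o : Fin (Fintype.card L) ≃ L) (μ : L → ℕ+) (m n : E → Index),
      (∀ γ, (G.highSub o γ).omega < 0) → IsScaleOrder μ o →
        G.scaleBound M K c o μ m n ≤ A * ∏ δ, r ^ (μ δ : ℕ) := by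
  have hM0 : 0 < M := by linarith
  -- Without lines there is a single scale attribution and the rate M^{-1/I} has no meaning; any r
  -- in [0, 1) serves.
  by_cases hL : Fintype.card L = 0
  · have := Fintype.card_eq_zero_iff.1 hL
    refine ⟨K ^ G.numLines / c ^ (2 * (G.numFaces - G.numExternalFaces)), 0, le_rfl, one_pos,
      fun o μ m n _ _ => ?_⟩
    unfold scaleBound
    simp only [Finset.univ_eq_empty, Finset.sum_empty, Finset.prod_empty, neg_zero, mul_zero,
      zpow_zero, mul_one, mul_assoc]
    refine mul_le_of_le_one_right (by positivity) (mul_le_one₀ ?_ ?_ ?_)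
    · exact Finset.prod_le_one (fun j _ => (legDecay_pos ..).le)
        fun j _ => legDecay_le_one hM hc ..
    · exact Finset.prod_nonneg fun j _ => (legDecay_pos ..).le
    · exact Finset.prod_le_one (fun j _ => (legDecay_pos ..).le)
        fun j _ => legDecay_le_one hM hc ..
  have hI : (0 : ℝ) < Fintype.card L := by exact_mod_cast Nat.pos_of_ne_zero hL
  refine ⟨K ^ G.numLines / c ^ (2 * (G.numFaces - G.numExternalFaces)),
    M ^ (-(1 / (Fintype.card L : ℝ))), by positivity,
    Real.rpow_lt_one_of_one_lt_of_neg hM (by simpa using hI), fun o μ m n ho hμ => ?_⟩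
  set X : ℤ := -∑ δ, ((μ δ : ℕ) : ℤ) + 2 * ∑ δ, (G.mainMult o δ : ℤ) * ((μ δ : ℕ) : ℤ) with hX
  -- The exponent is at most minus each scale; adding these bounds over all I lines shares the decay
  -- equally, at rate 1/I per scale.
  have hexp : (Fintype.card L : ℝ) * X ≤ -∑ δ, ((μ δ : ℕ) : ℝ) := by
    have := Finset.sum_le_sum (s := Finset.univ) fun δ (_ : δ ∈ Finset.univ) =>
      G.exponent_le ho hμ δ
    rw [Finset.sum_const, Finset.card_univ, nsmul_eq_mul, Finset.sum_neg_distrib, ← hX] at this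
    exact_mod_cast this
  have hpow : M ^ X ≤ ∏ δ, (M ^ (-(1 / (Fintype.card L : ℝ)))) ^ (μ δ : ℕ) := by
    rw [Finset.prod_pow_eq_pow_sum, ← Real.rpow_natCast, ← Real.rpow_mul hM0.le,
      ← Real.rpow_intCast]
    refine Real.rpow_le_rpow_of_exponent_le hM.le ?_
    push_cast
    rw [neg_mul, one_div, inv_mul_eq_div, ← neg_div, le_div_iff₀ hI]
    linarith
  have h1 : ∏ j, legDecay M c μ (m j) (G.rot.symm (Sum.inr j)) ≤ 1 :=
    Finset.prod_le_one (fun j _ => (legDecay_pos ..).le) fun j _ => legDecay_le_one hM hc ..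
  have h2 : ∏ j, legDecay M c μ (n j) (G.rot (Sum.inr j)) ≤ 1 :=
    Finset.prod_le_one (fun j _ => (legDecay_pos ..).le) fun j _ => legDecay_le_one hM hc ..
  have h3 : 0 ≤ ∏ j, legDecay M c μ (n j) (G.rot (Sum.inr j)) :=
    Finset.prod_nonneg fun j _ => (legDecay_pos ..).le
  unfold scaleBound
  rw [mul_assoc, mul_assoc, mul_assoc, ← mul_assoc (M ^ _), ← zpow_add₀ hM0.ne', ← hX]
  refine mul_le_mul_of_nonneg_left ?_ (by positivity)
  exact (mul_le_of_le_one_right (by positivity) (mul_le_one₀ h1 h3 h2)).trans hpow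

omit [Fintype E] in
/-- The sum over all scale attributions reconstructs the amplitude. -/
theorem hasSum_sliceAmplitude {Ω θ μ₀ M : ℝ} (hΩ₀ : 0 < Ω) (hΩ₁ : Ω < 1) (hθ : 0 < θ)
    (hM : 1 < M) {m n : E → Index} {B : (L → ℕ+) → ℝ} (hB : Summable B)
    (hs : ∀ μ, Summable (G.sliceTerm Ω θ μ₀ M μ m n))
    (hle : ∀ μ, G.sliceAmplitude Ω θ μ₀ M μ m n ≤ B μ) :
    Summable (G.term Ω θ μ₀ m n) ∧
      HasSum (fun μ : L → ℕ+ => G.sliceAmplitude Ω θ μ₀ M μ m n) (G.amplitude Ω θ μ₀ m n) ∧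
      G.amplitude Ω θ μ₀ m n ≤ ∑' μ, B μ := by
  have hnn := fun μ a => G.sliceTerm_nonneg (μ₀ := μ₀) hΩ₀ hΩ₁ hθ hM μ m n a
  have hAnn : ∀ μ, 0 ≤ G.sliceAmplitude Ω θ μ₀ M μ m n := fun μ => tsum_nonneg (hnn μ)
  have htnn : ∀ a, 0 ≤ G.term Ω θ μ₀ m n a := fun a =>
    Finset.prod_nonneg fun _ _ => propagator_nonneg hΩ₀ hΩ₁ hθ _ _ _ _
  have hBnn : ∀ μ, 0 ≤ B μ := fun μ => (hAnn μ).trans (hle μ)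
  have hAs : Summable fun μ => G.sliceAmplitude Ω θ μ₀ M μ m n :=
    Summable.of_nonneg_of_le hAnn hle hB
  have hAB : ∑' μ, G.sliceAmplitude Ω θ μ₀ M μ m n ≤ ∑' μ, B μ := hAs.tsum_le_tsum hle hB
  have hkey : ∑' a, ENNReal.ofReal (G.term Ω θ μ₀ m n a) =
      ENNReal.ofReal (∑' μ, G.sliceAmplitude Ω θ μ₀ M μ m n) := by
    rw [ENNReal.ofReal_tsum_of_nonneg hAnn hAs]
    simp only [sliceAmplitude, ENNReal.ofReal_tsum_of_nonneg (hnn _) (hs _)]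
    -- After exchanging the sums, each index assignment leaves a product over lines of sums of
    -- slices, expanded into a sum over all scale attributions.
    rw [ENNReal.tsum_comm]
    refine tsum_congr fun a => ?_
    unfold term sliceTerm weight
    rw [ENNReal.ofReal_prod_of_nonneg fun _ _ => propagator_nonneg hΩ₀ hΩ₁ hθ _ _ _ _]
    simp only [ofReal_propagator_eq_tsum hΩ₀ hΩ₁ hθ hM]
    rw [ennreal_prod_tsum]
    refine tsum_congr fun μ => ?_
    rw [ENNReal.ofReal_prod_of_nonneg fun _ _ =>
      slicePropagator_nonneg hΩ₀ hΩ₁ hθ hM _ _ _ _ _]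
  have hts := (summable_and_tsum_le_of_ofReal htnn (tsum_nonneg hAnn) hkey.le).1
  have heq : G.amplitude Ω θ μ₀ m n = ∑' μ, G.sliceAmplitude Ω θ μ₀ M μ m n := by
    rw [← ENNReal.ofReal_tsum_of_nonneg htnn hts,
      ENNReal.ofReal_eq_ofReal_iff (tsum_nonneg htnn) (tsum_nonneg hAnn)] at hkey
    exact hkey
  exact ⟨hts, heq ▸ hAs.hasSum, heq ▸ hAB⟩

end RibbonGraph

end RibbonPhi4

end

/-! ### Assembly of the bounds. -/

theorem mainTheorem6 (Ω θ μ₀ M : ℝ) (hΩ₀ : 0 < Ω) (hΩ₁ : Ω < 1) (hθ : 0 < θ) (hM : 1 < M) :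
    ∃ K c : ℝ, 0 < K ∧ 0 < c ∧
      ∀ (L E : Type*) [Fintype L] [Fintype E] (G : RibbonPhi4.RibbonGraph L E),
        G.IsPhi4 → G.IsConnected → Nonempty E →
        -- the amplitude bound at fixed scale attribution
        (∀ (μ : L → ℕ+) (o : Fin (Fintype.card L) ≃ L),
          RibbonPhi4.RibbonGraph.IsScaleOrder μ o →
          ∀ m n : E → RibbonPhi4.Index,
            Summable (G.sliceTerm Ω θ μ₀ M μ m n) ∧
            G.sliceAmplitude Ω θ μ₀ M μ m n ≤ G.scaleBound M K c o μ m n) ∧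
        -- convergence of the sum over the scale attributions with a given order of the lines
        (∀ o : Fin (Fintype.card L) ≃ L,
          (∀ γ, (G.highSub o γ).omega < 0) →
          ∀ m n : E → RibbonPhi4.Index,
            Summable (fun μ : {μ : L → ℕ+ // RibbonPhi4.RibbonGraph.IsScaleOrder μ o} =>
              G.scaleBound M K c o μ.1 m n)) ∧
        -- convergence of the sum over all scale attributions
        (∀ o : (L → ℕ+) → (Fin (Fintype.card L) ≃ L),
          (∀ μ, RibbonPhi4.RibbonGraph.IsScaleOrder μ (o μ)) →
          (∀ μ γ, (G.highSub (o μ) γ).omega < 0) →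
          ∀ m n : E → RibbonPhi4.Index,
            Summable (fun μ : L → ℕ+ => G.scaleBound M K c (o μ) μ m n) ∧
            Summable (G.term Ω θ μ₀ m n) ∧
            HasSum (fun μ : L → ℕ+ => G.sliceAmplitude Ω θ μ₀ M μ m n)
              (G.amplitude Ω θ μ₀ m n) ∧
            G.amplitude Ω θ μ₀ m n ≤ ∑' μ : L → ℕ+, G.scaleBound M K c (o μ) μ m n) ∧
        -- the degree of the subgraphs and of the whole graph in terms of legs, genus and
        -- external faces
        (∀ (o : Fin (Fintype.card L) ≃ L) (γ : Fin (Fintype.card L)),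
          ((G.highSub o γ).omega : ℚ) =
            (2 - ((G.highSub o γ).numLegs : ℚ) / 2) -
              2 * (2 * (G.highSub o γ).genus + (G.highSub o γ).numExternalFaces - 1)) ∧
        (∀ (o : Fin (Fintype.card L) ≃ L) (γ : Fin (Fintype.card L)), (γ : ℕ) = 0 →
          (G.highSub o γ).omega = G.omega) ∧
        (G.omega : ℚ) =
          (2 - (G.numLegs : ℚ) / 2) - 2 * (2 * G.genus + G.numExternalFaces - 1) := by
  obtain ⟨ε, d, hε, hd, hrate⟩ := RibbonPhi4.exists_rate hΩ₀ hΩ₁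
  obtain ⟨κ, hκ, hJ⟩ := RibbonPhi4.tsum_sliceMajorant_le hΩ₀ hΩ₁ hθ hM hε hd hrate
  -- Each line decays at rate ε/2 = 2c in its indices, which fixes c; the factor (1 + c)^4 in K pays
  -- for the sums over reference indices.
  refine ⟨κ * (1 + ε / 4) ^ 4, ε / 4, by positivity, by positivity, ?_⟩
  intro L E _ _ G hG _ _
  have hK : 0 < κ * (1 + ε / 4) ^ 4 := by positivity
  have hc : 0 < ε / 4 := by positivity
  have hbound := fun (μ : L → ℕ+) (o : Fin (Fintype.card L) ≃ L) (m n : E → RibbonPhi4.Index) =>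
    RibbonPhi4.summable_and_tsum_le_of_ofReal
      (G.sliceTerm_nonneg (μ₀ := μ₀) hΩ₀ hΩ₁ hθ hM μ m n)
      (G.scaleBound_nonneg hM hK hc o μ m n)
      (G.tsum_sliceTerm_le hΩ₀ hΩ₁ hθ hM hε hκ (fun α h0 h1 => (hrate α h0 h1).1) hJ o μ m n)
  obtain ⟨A, r, hr0, hr1, hA⟩ := G.exists_scaleBound_le hM hK hc
  have hsum := (RibbonPhi4.summable_prod_pow (L := L) hr0 hr1).mul_left A
  refine ⟨fun μ o _ m n => hbound μ o m n, fun o ho m n => ?_, fun o ho hω m n => ?_,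
    fun o γ => (G.highSub o γ).omega_eq_of_isPhi4 (hG.sub _), G.omega_highSub_zero,
    G.omega_eq_of_isPhi4 hG⟩
  · exact Summable.of_nonneg_of_le (fun μ => G.scaleBound_nonneg hM hK hc o μ.1 m n)
      (fun μ => hA o μ.1 m n ho μ.2) (hsum.subtype _)
  · have hB : Summable fun μ : L → ℕ+ =>
        G.scaleBound M (κ * (1 + ε / 4) ^ 4) (ε / 4) (o μ) μ m n :=
      Summable.of_nonneg_of_le (fun μ => G.scaleBound_nonneg hM hK hc (o μ) μ m n)
        (fun μ => hA (o μ) μ m n (hω μ) (ho μ)) hsum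
    exact ⟨hB, G.hasSum_sliceAmplitude hΩ₀ hΩ₁ hθ hM hB (fun μ => (hbound μ (o μ) m n).1)
      fun μ => (hbound μ (o μ) m n).2⟩
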